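/- Let $d\ge 1$ and let $a:\mathbb R^d\to\mathbb R$ satisfy $a(x)\ge 0$, $a(x)=a(-x)$, $a\in L^\infty(\mathbb R^d)\cap L^1(\mathbb R^d)$, $\int_{\mathbb R^d}a(x)\,dx=1$, $\int_{\mathbb R^d}|x|^2a(x)\,dx<\infty$, and, for some constants $C_1$, $b>0$ and $p\ge 1$, $$0\le a(x)\le C_1e^{-b|x|^p}\qquad\text{for all }x\in\mathbb R^d .$$ Let $a^{*k}$ denote the $k$-fold convolution power of $a$ (with $a^{*1}=a$), let $$v(x,t)=e^{-t}\sum_{k=1}^{\infty}\frac{t^k a^{*k}(x)}{k!},$$ let $\sigma=(\sigma_{ij})$, $\sigma_{ij}=\int_{\mathbb R^d}x_ix_ja(x)\,dx$, be the covariance matrix of $a$, and put $c(\sigma)=(2\pi)^{-d/2}|\det\sigma|^{-1/2}$. Then, as $t\to\infty$: 1) For every real $r>0$, $$v(x,t)=\frac{c(\sigma)}{t^{d/2}}\,e^{-\frac{(\sigma^{-1}x,x)}{2t}}\,(1+o(1))$$ uniformly in $x\in\mathbb R^d$ with $|x|\le r\,t^{1/2}$. 2) Let $0<\delta<1$ and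 $r\in\mathbb R^d\setminus\{0\}$, and let $x=x(t)$ satisfy $x(t)=r\,t^{\frac{1+\delta}{2}}(1+o(1))$, that is, $t^{-\frac{1+\delta}{2}}x(t)\to r$ in $\mathbb R^d$ as $t\to\infty$. Then $$v(x(t),t)=e^{-\frac{(\sigma^{-1}x(t),x(t))}{2t}(1+o(1))}=e^{-\frac12(\sigma^{-1}r,r)\,t^{\delta}(1+o(1))}.$$ -/

import Mathlib

open MeasureTheory Filter Topology
open scoped Nat Matrix

noncomputable section

/-- `iterConv a n` is the `(n+1)`-fold convolution power of `a` on `ℝ^d`: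
`iterConv a 0 = a` and `iterConv a (n+1) = (iterConv a n) * a`. -/
def iterConv {d : ℕ} (a : EuclideanSpace ℝ (Fin d) → ℝ) :
    ℕ → EuclideanSpace ℝ (Fin d) → ℝ
  | 0 => a
  | n + 1 => convolution (iterConv a n) a (ContinuousLinearMap.mul ℝ ℝ) volume

/-- The regularized heat kernel `v(x,t) = e^{-t} ∑_{k ≥ 1} t^k a^{*k}(x) / k!`
(summation index shifted by one, `k = n + 1`). -/
def heatKernelReg {d : ℕ} (a : EuclideanSpace ℝ (Fin d) → ℝ)
    (x : EuclideanSpace ℝ (Fin d)) (t : ℝ) : ℝ :=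
  Real.exp (-t) * ∑' n : ℕ, t ^ (n + 1) * iterConv a n x / ((n + 1)! : ℝ)

/-- The covariance matrix `σ_{ij} = ∫ x_i x_j a(x) dx`. -/
def covMatrix {d : ℕ} (a : EuclideanSpace ℝ (Fin d) → ℝ) : Matrix (Fin d) (Fin d) ℝ :=
  Matrix.of fun i j => ∫ x, x i * x j * a x

/-- The quadratic form `(σ⁻¹ x, x)` of the inverse covariance matrix. -/
def invCovForm {d : ℕ} (a : EuclideanSpace ℝ (Fin d) → ℝ)
    (x : EuclideanSpace ℝ (Fin d)) : ℝ :=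
  ((covMatrix a)⁻¹ *ᵥ x.ofLp) ⬝ᵥ x.ofLp

/-- The constant `c(σ) = (2π)^{-d/2} |det σ|^{-1/2}`. -/
def gaussConst {d : ℕ} (a : EuclideanSpace ℝ (Fin d) → ℝ) : ℝ :=
  (2 * Real.pi) ^ (-(d : ℝ) / 2) * |(covMatrix a).det| ^ (-(1 : ℝ) / 2)

end

/-!
The kernel `heatKernelReg a · t` is the absolutely continuous part of the law at time `t` of a
compound Poisson process with jump density `a`; the theorem is a local limit theorem for it together
with its extension to moderate deviations.

**Diffusive scale.** The Fourier transform of `a` is the real function `cosTransform a`, and that of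
`heatKernelReg a · t` is `e^{-t} (exp (t cosTransform a) - 1)`. The first summand `e^{-t} t a` of the
kernel, which need not be continuous or have an integrable transform, is split off and bounded by
the supremum of `a`. The convolution powers from the second one on are continuous with integrable
transforms, because `cosTransform a ^ 2` is integrable
(`IsJumpKernel.integrable_cosTransform_sq`), and Fourier inversion applies to them. What has to be
proved is then that the rescaled symbol converges in `L¹` to a Gaussian
(`IsJumpKernel.tendsto_integral_heatSymbol_sub`). The two estimates this needs, a bound
`1 - cosTransform a ξ ≥ κ ‖ξ‖²` near `0` and a gap away from `0`, both follow from the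
Riemann–Lebesgue lemma and the inequality `1 - cos 2u ≤ 4 (1 - cos u)`
(`IsJumpKernel.exists_one_sub_cosTransform_ge`); they also show that the covariance matrix is
positive definite. The result is `IsJumpKernel.exists_local_limit`, and where the Gaussian is at
least a multiple of `t ^ (-d / 2)` the additive error is a relative one
(`IsJumpKernel.eventually_heatKernelReg_eq`).

**Moderate deviations.** It is enough to show that `log (heatKernelReg a (x t) t) / t ^ δ` tends to
`-(σ⁻¹ r, r) / 2` (`IsJumpKernel.tendsto_log_heatKernelReg`).

* The upper bound is a Chernoff bound. Multiplication by `exp ⟪l, ·⟫` commutes with convolution, so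
  `heatKernelReg a x t ≤ K exp (t (M(l) - 1) - ⟪l, x⟫)` with `M` the moment generating function of
  `a`, and `l = t ^ (-(1 - δ) / 2) σ⁻¹ r` tends to `0`, where `M(l) - 1` is quadratic up to a cubic
  error (`IsJumpKernel.exists_heatKernelReg_le_exp`).
* The lower bound uses the semigroup property. The time `t` is cut into about `b t ^ δ` equal pieces,
  over each of which the displacement is of diffusive order, so that the first part bounds each
  factor from below (`IsJumpKernel.exists_exp_le_heatKernelReg`). The constants lost in each of
  the `b t ^ δ` steps and the excursions allowed around the straight path change the rate by a
  quantity which vanishes as `b → 0`.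
-/

variable {d : ℕ} {a : EuclideanSpace ℝ (Fin d) → ℝ}

/-! ### Convolution powers -/

/-- A bounded symmetric probability density on `ℝ^d`; the bound holds at every point, not only
almost everywhere, because the convolution powers are evaluated pointwise. -/
structure IsJumpKernel (a : EuclideanSpace ℝ (Fin d) → ℝ) : Prop where
  nonneg : ∀ x, 0 ≤ a x
  symm : ∀ x, a x = a (-x)
  integrable : Integrable a volume
  mass : ∫ x, a x = 1
  bdd : ∃ K, ∀ x, a x ≤ K

theorem iterConv_succ_apply (n : ℕ) (x : EuclideanSpace ℝ (Fin d)) :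
    iterConv a (n + 1) x = ∫ y, iterConv a n (x - y) * a y := by
  rw [iterConv, convolution_eq_swap]; rfl

theorem iterConv_nonneg (ha : ∀ x, 0 ≤ a x) (n : ℕ) (x : EuclideanSpace ℝ (Fin d)) :
    0 ≤ iterConv a n x := by
  induction n generalizing x with
  | zero => exact ha x
  | succ n ih =>
    rw [iterConv_succ_apply]
    exact integral_nonneg fun y => mul_nonneg (ih _) (ha _)

theorem integrable_iterConv (ha : Integrable a volume) (n : ℕ) :
    Integrable (iterConv a n) volume := by
  induction n with
  | zero => exact ha
  | succ n ih => exact ih.integrable_convolution _ ha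

/-- The exponential tilt of the pointwise bound: multiplying `a` by `exp ⟪l, ·⟫` multiplies its
convolution powers by the same factor, and convolution with the tilted density raises the supremum
at most by the mass `M` of the tilted density. -/
theorem iterConv_le_tilt (ha : ∀ x, 0 ≤ a x) (l : EuclideanSpace ℝ (Fin d)) {K : ℝ}
    (hK : ∀ x, a x ≤ K * Real.exp (-inner ℝ l x))
    (hint : Integrable (fun y => Real.exp (inner ℝ l y) * a y) volume) (n : ℕ)
    (x : EuclideanSpace ℝ (Fin d)) :
    iterConv a n x ≤ K * (∫ y, Real.exp (inner ℝ l y) * a y) ^ n * Real.exp (-inner ℝ l x) := by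
  induction n generalizing x with
  | zero => simpa [iterConv] using hK x
  | succ n ih =>
    set M := ∫ y, Real.exp (inner ℝ l y) * a y with hM
    rw [iterConv_succ_apply]
    calc ∫ y, iterConv a n (x - y) * a y
        ≤ ∫ y, (K * M ^ n * Real.exp (-inner ℝ l x)) * (Real.exp (inner ℝ l y) * a y) := by
          refine integral_mono_of_nonneg (ae_of_all _ fun y =>
            mul_nonneg (iterConv_nonneg ha n _) (ha y)) (hint.const_mul _) (ae_of_all _ fun y => ?_)
          have h1 := mul_le_mul_of_nonneg_right (ih (x - y)) (ha y)
          refine h1.trans_eq ?_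
          rw [inner_sub_right, neg_sub, sub_eq_add_neg, Real.exp_add]
          ring
      _ = K * M ^ (n + 1) * Real.exp (-inner ℝ l x) := by
          rw [integral_const_mul, ← hM]; ring

theorem IsJumpKernel.iterConv_le (h : IsJumpKernel a) {K : ℝ} (hK : ∀ x, a x ≤ K) (n : ℕ)
    (x : EuclideanSpace ℝ (Fin d)) : iterConv a n x ≤ K := by
  have := iterConv_le_tilt h.nonneg 0 (K := K) (by simpa using hK)
    (by simpa using h.integrable) n x
  simpa [h.mass] using this

/-- Products of convolution powers occurring in a convolution integral are integrable: one factor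
is integrable and the other one bounded. -/
theorem IsJumpKernel.integrable_mul_sub (h : IsJumpKernel a) (m n : ℕ)
    (x : EuclideanSpace ℝ (Fin d)) :
    Integrable (fun y => iterConv a m y * iterConv a n (x - y)) volume := by
  obtain ⟨K, hK⟩ := h.bdd
  refine (integrable_iterConv h.integrable m).mul_bdd (c := K)
    ((integrable_iterConv h.integrable n).comp_sub_left x).aestronglyMeasurable
    (ae_of_all _ fun y => ?_)
  rw [Real.norm_of_nonneg (iterConv_nonneg h.nonneg _ _)]
  exact h.iterConv_le hK _ _

theorem IsJumpKernel.integral_mul_sub (h : IsJumpKernel a) (m n : ℕ)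
    (x : EuclideanSpace ℝ (Fin d)) :
    ∫ y, iterConv a m y * iterConv a n (x - y) = iterConv a (m + n + 1) x := by
  have hnorm : ∀ k, (fun x => ‖iterConv a k x‖) = iterConv a k := fun k =>
    funext fun x => Real.norm_of_nonneg (iterConv_nonneg h.nonneg _ _)
  have hex : ∀ m n x, ConvolutionExistsAt (iterConv a m) (iterConv a n) x
      (ContinuousLinearMap.mul ℝ ℝ) volume := fun m n x => h.integrable_mul_sub m n x
  induction n generalizing x with
  | zero => rfl
  | succ n ih =>
    have hassoc := convolution_assoc (μ := volume) (ν := volume)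
      (f := iterConv a m) (g := iterConv a n) (k := iterConv a 0) (x₀ := x)
      (ContinuousLinearMap.mul ℝ ℝ) (ContinuousLinearMap.mul ℝ ℝ)
      (ContinuousLinearMap.mul ℝ ℝ) (ContinuousLinearMap.mul ℝ ℝ)
      (fun x y z => by simp [mul_assoc])
      (integrable_iterConv h.integrable m).aestronglyMeasurable
      (integrable_iterConv h.integrable n).aestronglyMeasurable
      (integrable_iterConv h.integrable 0).aestronglyMeasurable
      (ae_of_all _ fun y => hex m n y)
      (ae_of_all _ fun y => by rw [hnorm, hnorm]; exact hex n 0 y)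
      (by rw [hnorm, hnorm, hnorm]; exact hex m (n + 1) x)
    have hfun : convolution (iterConv a m) (iterConv a n) (ContinuousLinearMap.mul ℝ ℝ) volume
        = iterConv a (m + n + 1) := funext fun y => ih y
    rw [hfun] at hassoc
    exact hassoc.symm

/-- The convolution of an integrable function with a bounded one is continuous: it is the uniform
limit of convolutions with continuous functions of compact support. -/
theorem continuous_convolution_of_integrable_of_bounded {f g : EuclideanSpace ℝ (Fin d) → ℝ}
    (hf : Integrable f volume) (hg : AEStronglyMeasurable g volume) {K : ℝ}
    (hK : ∀ x, ‖g x‖ ≤ K) :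
    Continuous (convolution f g (ContinuousLinearMap.mul ℝ ℝ) volume) := by
  have hloc : LocallyIntegrable g volume := fun x =>
    ⟨Metric.ball x 1, Metric.ball_mem_nhds x one_pos,
      (integrableOn_const (C := K) (by exact measure_ball_lt_top.ne)).mono' hg.restrict
        (ae_of_all _ hK)⟩
  have hK0 : 0 ≤ K := (norm_nonneg _).trans (hK 0)
  refine continuous_of_uniform_approx_of_continuous fun u hu => ?_
  obtain ⟨ε, hε, hεu⟩ := Metric.mem_uniformity_dist.1 hu
  obtain ⟨k, hkc, hk, hkcont, hkint⟩ :=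
    hf.exists_hasCompactSupport_integral_sub_le (ε := ε / (K + 1) / 2) (by positivity)
  refine ⟨_, hkc.continuous_convolution_left (ContinuousLinearMap.mul ℝ ℝ) hkcont hloc,
    fun y => hεu ?_⟩
  have hi : ∀ q : EuclideanSpace ℝ (Fin d) → ℝ, Integrable q volume →
      Integrable (fun t => q t * g (y - t)) volume := fun q hq =>
    hq.mul_bdd (c := K) (hg.comp_quasiMeasurePreserving
      (quasiMeasurePreserving_sub_left_of_right_invariant volume y)) (ae_of_all _ fun t => hK _)
  rw [Real.dist_eq, convolution_def, convolution_def]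
  simp only [ContinuousLinearMap.mul_apply']
  rw [← integral_sub (hi f hf) (hi k hkint)]
  calc |∫ t, (f t * g (y - t) - k t * g (y - t))|
      ≤ ∫ t, ‖f t - k t‖ * K := by
        rw [← Real.norm_eq_abs]
        refine norm_integral_le_of_norm_le ((hf.sub hkint).norm.mul_const K)
          (ae_of_all _ fun t => ?_)
        rw [← sub_mul, norm_mul]
        exact mul_le_mul_of_nonneg_left (hK _) (norm_nonneg _)
    _ = (∫ t, ‖f t - k t‖) * K := by rw [integral_mul_const]
    _ ≤ ε / (K + 1) / 2 * K := mul_le_mul_of_nonneg_right hk hK0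
    _ < ε := by
        rw [div_div, div_mul_eq_mul_div, div_lt_iff₀ (by positivity)]
        nlinarith

theorem IsJumpKernel.continuous_iterConv_succ (h : IsJumpKernel a) (n : ℕ) :
    Continuous (iterConv a (n + 1)) := by
  obtain ⟨K, hK⟩ := h.bdd
  exact continuous_convolution_of_integrable_of_bounded (integrable_iterConv h.integrable n)
    h.integrable.aestronglyMeasurable (K := K) fun x => by
      rw [Real.norm_of_nonneg (h.nonneg x)]; exact hK x

/-! ### The characteristic function -/

/-- The Fourier transform of an even real density, which is real:
`cosTransform a ξ = ∫ cos (2π ⟪x, ξ⟫) a(x) dx`. -/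
noncomputable def cosTransform (a : EuclideanSpace ℝ (Fin d) → ℝ)
    (ξ : EuclideanSpace ℝ (Fin d)) : ℝ :=
  ∫ x, Real.cos (2 * Real.pi * inner ℝ x ξ) * a x

theorem integrable_cos_mul (ha : Integrable a volume) (ξ : EuclideanSpace ℝ (Fin d)) :
    Integrable (fun x => Real.cos (2 * Real.pi * inner ℝ x ξ) * a x) volume :=
  ha.bdd_mul (c := 1) (by fun_prop) (ae_of_all _ fun x => by
    simpa using Real.abs_cos_le_one _)

open FourierTransform in
theorem IsJumpKernel.fourier_eq (h : IsJumpKernel a) (ξ : EuclideanSpace ℝ (Fin d)) :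
    𝓕 (fun x => (a x : ℂ)) ξ = (cosTransform a ξ : ℂ) := by
  have hsin : Integrable (fun x => Real.sin (2 * Real.pi * inner ℝ x ξ) * a x) volume :=
    h.integrable.bdd_mul (c := 1) (by fun_prop) (ae_of_all _ fun x => by
      simpa using Real.abs_sin_le_one _)
  have hodd : ∫ x, Real.sin (2 * Real.pi * inner ℝ x ξ) * a x = 0 := by
    have h1 := integral_neg_eq_self (μ := volume)
      (fun x => Real.sin (2 * Real.pi * inner ℝ x ξ) * a x)
    have h2 : ∀ x, Real.sin (2 * Real.pi * inner ℝ (-x) ξ) * a (-x)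
        = -(Real.sin (2 * Real.pi * inner ℝ x ξ) * a x) := fun x => by
      rw [inner_neg_left, mul_neg, Real.sin_neg, ← h.symm, neg_mul]
    simp_rw [h2, integral_neg] at h1
    linarith
  rw [Real.fourier_eq']
  have hpt : ∀ x, Complex.exp (↑(-2 * Real.pi * inner ℝ x ξ) * Complex.I) • (a x : ℂ)
      = ((Real.cos (2 * Real.pi * inner ℝ x ξ) * a x : ℝ) : ℂ)
        - ((Real.sin (2 * Real.pi * inner ℝ x ξ) * a x : ℝ) : ℂ) * Complex.I := fun x => by
    rw [Complex.exp_mul_I, ← Complex.ofReal_cos, ← Complex.ofReal_sin, smul_eq_mul,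
      show -2 * Real.pi * inner ℝ x ξ = -(2 * Real.pi * inner ℝ x ξ) by ring,
      Real.cos_neg, Real.sin_neg]
    push_cast; ring
  simp_rw [hpt]
  rw [integral_sub (integrable_cos_mul h.integrable ξ).ofReal (hsin.ofReal.mul_const _),
    integral_mul_const, integral_complex_ofReal, integral_complex_ofReal, hodd]
  simp [cosTransform]

open FourierTransform in
theorem IsJumpKernel.fourier_iterConv (h : IsJumpKernel a) (n : ℕ)
    (ξ : EuclideanSpace ℝ (Fin d)) :
    𝓕 (fun x => (iterConv a n x : ℂ)) ξ = ((cosTransform a ξ ^ (n + 1) : ℝ) : ℂ) := by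
  induction n with
  | zero => simpa [iterConv] using h.fourier_eq ξ
  | succ n ih =>
    have hfun : (fun x => (iterConv a (n + 1) x : ℂ)) = convolution
        (fun x => (iterConv a n x : ℂ)) (fun x => (a x : ℂ)) (ContinuousLinearMap.mul ℂ ℂ)
        volume := by
      funext x
      rw [iterConv, convolution_def, convolution_def, ← integral_complex_ofReal]
      simp
    rw [hfun]
    refine (Real.fourier_mul_convolution_eq (R := ℂ)
      (f₁ := fun x => (iterConv a n x : ℂ)) (f₂ := fun x => (a x : ℂ))
      (integrable_iterConv h.integrable n).ofReal
      h.integrable.ofReal ξ).trans ?_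
    rw [ih, h.fourier_eq]
    push_cast; ring

theorem continuous_cosTransform (ha : Integrable a volume) : Continuous (cosTransform a) := by
  refine continuous_of_dominated (bound := fun x => ‖a x‖)
    (fun ξ => (integrable_cos_mul ha ξ).aestronglyMeasurable)
    (fun ξ => ae_of_all _ fun x => ?_) ha.norm (ae_of_all _ fun x => by fun_prop)
  rw [norm_mul]
  exact mul_le_of_le_one_left (norm_nonneg _) (Real.abs_cos_le_one _)

theorem IsJumpKernel.abs_cosTransform_le (h : IsJumpKernel a) (ξ : EuclideanSpace ℝ (Fin d)) :
    |cosTransform a ξ| ≤ 1 := by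
  rw [← h.mass, ← Real.norm_eq_abs]
  refine norm_integral_le_of_norm_le h.integrable (ae_of_all _ fun x => ?_)
  rw [norm_mul, Real.norm_of_nonneg (h.nonneg x)]
  exact mul_le_of_le_one_left (h.nonneg x) (Real.abs_cos_le_one _)

theorem IsJumpKernel.one_sub_cosTransform (h : IsJumpKernel a) (ξ : EuclideanSpace ℝ (Fin d)) :
    1 - cosTransform a ξ = ∫ x, (1 - Real.cos (2 * Real.pi * inner ℝ x ξ)) * a x := by
  nth_rw 1 [← h.mass]
  rw [cosTransform, ← integral_sub h.integrable (integrable_cos_mul h.integrable ξ)]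
  congr with x; ring

/-- The duplication formula `1 - cos 2u = 2 (1 - cos u) (1 + cos u)` bounds the growth of
`1 - cosTransform a` along dyadic scales. -/
theorem IsJumpKernel.one_sub_cosTransform_two_smul_le (h : IsJumpKernel a)
    (ξ : EuclideanSpace ℝ (Fin d)) :
    1 - cosTransform a ((2 : ℝ) • ξ) ≤ 4 * (1 - cosTransform a ξ) := by
  rw [h.one_sub_cosTransform, h.one_sub_cosTransform, ← integral_const_mul]
  have hi : ∀ ξ : EuclideanSpace ℝ (Fin d),
      Integrable (fun x => (1 - Real.cos (2 * Real.pi * inner ℝ x ξ)) * a x) volume := fun ξ => by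
    refine (h.integrable.sub (integrable_cos_mul h.integrable ξ)).congr (ae_of_all _ fun x => ?_)
    simp only [Pi.sub_apply]; ring
  refine integral_mono (hi _) ((hi ξ).const_mul 4) fun x => ?_
  dsimp only
  rw [← mul_assoc]
  refine mul_le_mul_of_nonneg_right ?_ (h.nonneg x)
  rw [inner_smul_right, show 2 * Real.pi * (2 * inner ℝ x ξ) = 2 * (2 * Real.pi * inner ℝ x ξ) by
    ring, Real.cos_two_mul]
  nlinarith [sq_nonneg (1 - Real.cos (2 * Real.pi * inner ℝ x ξ))]

open FourierTransform in
theorem IsJumpKernel.tendsto_cosTransform_cocompact (h : IsJumpKernel a) :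
    Tendsto (cosTransform a) (cocompact (EuclideanSpace ℝ (Fin d))) (𝓝 0) := by
  have h1 := tendsto_integral_exp_inner_smul_cocompact (fun x => (a x : ℂ))
  have h2 : Tendsto (𝓕 (fun x => (a x : ℂ))) (cocompact (EuclideanSpace ℝ (Fin d))) (𝓝 0) := h1
  have h3 := (Complex.continuous_re.tendsto 0).comp h2
  refine h3.congr fun ξ => ?_
  simp [h.fourier_eq]

/-- Quadratic lower bound on `1 - cosTransform a` near the origin, uniform gap away from it.
By the Riemann–Lebesgue lemma the gap is at least `1/2` outside a ball of radius `R`, and the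
duplication inequality transports it down the dyadic scales. -/
theorem IsJumpKernel.exists_one_sub_cosTransform_ge (h : IsJumpKernel a) :
    ∃ R κ : ℝ, 0 < R ∧ 0 < κ ∧
      (∀ ξ, ‖ξ‖ ≤ R → κ * ‖ξ‖ ^ 2 ≤ 1 - cosTransform a ξ) ∧
      (∀ ξ, R < ‖ξ‖ → cosTransform a ξ ≤ 1 / 2) := by
  have h1 : ∀ᶠ ξ in cocompact (EuclideanSpace ℝ (Fin d)), cosTransform a ξ < 1 / 2 :=
    h.tendsto_cosTransform_cocompact.eventually (gt_mem_nhds (by norm_num))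
  rw [← Metric.cobounded_eq_cocompact,
    (Metric.hasBasis_cobounded_compl_closedBall 0).eventually_iff] at h1
  obtain ⟨R₀, -, hR₀⟩ := h1
  set R := max R₀ 1 with hR
  have hRpos : 0 < R := lt_of_lt_of_le one_pos (le_max_right _ _)
  have hfar : ∀ ξ : EuclideanSpace ℝ (Fin d), R < ‖ξ‖ → cosTransform a ξ ≤ 1 / 2 := fun ξ hξ => by
    refine (hR₀ ?_).le
    simpa using (le_max_left R₀ 1).trans_lt hξ
  have hpow : ∀ (n : ℕ) (ξ : EuclideanSpace ℝ (Fin d)),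
      1 - cosTransform a ((2 : ℝ) ^ n • ξ) ≤ 4 ^ n * (1 - cosTransform a ξ) := fun n ξ => by
    induction n with
    | zero => simp
    | succ n ih =>
      have := h.one_sub_cosTransform_two_smul_le ((2 : ℝ) ^ n • ξ)
      rw [smul_smul] at this
      rw [pow_succ', pow_succ']
      linarith
  refine ⟨R, 1 / (8 * R ^ 2), hRpos, by positivity, fun ξ hξ => ?_, hfar⟩
  rcases eq_or_ne ξ 0 with rfl | hne
  · have := (abs_le.1 (h.abs_cosTransform_le 0)).2
    simp only [norm_zero]
    nlinarith
  have hξ0 : 0 < ‖ξ‖ := norm_pos_iff.2 hne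
  obtain ⟨n, hn1, hn2⟩ := exists_nat_pow_near (x := R / ‖ξ‖) (y := 2)
    ((one_le_div hξ0).2 hξ) one_lt_two
  rw [le_div_iff₀ hξ0] at hn1
  rw [div_lt_iff₀ hξ0] at hn2
  have hp := hpow (n + 1) ξ
  have hf := hfar ((2 : ℝ) ^ (n + 1) • ξ) (by
    rw [norm_smul, Real.norm_of_nonneg (by positivity)]; exact hn2)
  have h4 : (4 : ℝ) ^ (n + 1) * ‖ξ‖ ^ 2 ≤ 4 * R ^ 2 := by
    have : (2 ^ n * ‖ξ‖) ^ 2 ≤ R ^ 2 := pow_le_pow_left₀ (by positivity) hn1 2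
    calc (4 : ℝ) ^ (n + 1) * ‖ξ‖ ^ 2 = 4 * (2 ^ n * ‖ξ‖) ^ 2 := by
          rw [show (4 : ℝ) = 2 ^ 2 by norm_num, ← pow_mul]; ring
      _ ≤ 4 * R ^ 2 := by linarith
  have h5 : 1 / 2 ≤ 4 ^ (n + 1) * (1 - cosTransform a ξ) := by linarith
  have h4pos : (0 : ℝ) < 4 ^ (n + 1) := by positivity
  rw [div_mul_eq_mul_div, one_mul, div_le_iff₀ (by positivity)]
  refine le_of_mul_le_mul_left ?_ h4pos
  nlinarith [mul_le_mul_of_nonneg_right h5 (by positivity : 0 ≤ 8 * R ^ 2)]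

open FourierTransform in
/-- Since `cosTransform a ^ 2` is the nonnegative Fourier transform of the bounded density `a * a`,
pairing it with wide Gaussians bounds its integral by the supremum of `a * a`. -/
theorem IsJumpKernel.integrable_cosTransform_sq (h : IsJumpKernel a) :
    Integrable (fun ξ => cosTransform a ξ ^ 2) volume := by
  obtain ⟨K, hK⟩ := h.bdd
  have hcont := continuous_cosTransform h.integrable
  have hi1 : Integrable (fun x => (iterConv a 1 x : ℂ)) volume :=
    (integrable_iterConv h.integrable 1).ofReal
  set g : ℕ → EuclideanSpace ℝ (Fin d) → ℝ := fun n ξ => Real.exp (-(1 / (n + 1)) * ‖ξ‖ ^ 2)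
    with hg
  have hgint : ∀ n, Integrable (g n) volume := fun n => by
    have := GaussianFourier.integrable_cexp_neg_mul_sq_norm_add (V := EuclideanSpace ℝ (Fin d))
      (b := ((1 / (n + 1) : ℝ) : ℂ)) (by rw [Complex.ofReal_re]; positivity) 0 0
    refine this.re.congr (ae_of_all _ fun ξ => ?_)
    simp only [hg, RCLike.re_to_complex]
    rw [← Complex.exp_ofReal_re]
    congr 1
    push_cast; simp
  have hbound : ∀ n, ∫ ξ, g n ξ * cosTransform a ξ ^ 2 ≤ K := fun n => by
    set b : ℝ := 1 / (n + 1) with hb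
    have hbpos : 0 < b := by positivity
    have hflip := VectorFourier.integral_fourierIntegral_smul_eq_flip
      (L := innerₗ (EuclideanSpace ℝ (Fin d))) (μ := volume) (ν := volume)
      Real.continuous_fourierChar continuous_inner
      (hgint n).ofReal hi1
    have hG : ∀ w : EuclideanSpace ℝ (Fin d), 𝓕 (fun ξ => (g n ξ : ℂ)) w
        = (((Real.pi / b) ^ ((d : ℝ) / 2) * Real.exp (-(Real.pi ^ 2 / b) * ‖w‖ ^ 2) : ℝ) : ℂ) := by
      intro w
      have := fourier_gaussian_innerProductSpace (V := EuclideanSpace ℝ (Fin d))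
        (b := (b : ℂ)) (by simpa using hbpos) w
      have hgc : (fun ξ => (g n ξ : ℂ)) = fun v : EuclideanSpace ℝ (Fin d) =>
          Complex.exp (-(b : ℂ) * ‖v‖ ^ 2) := by
        funext v; simp only [hg, hb]; push_cast; rfl
      rw [hgc, this, finrank_euclideanSpace_fin, Complex.ofReal_mul,
        Complex.ofReal_cpow (by positivity), Complex.ofReal_exp]
      push_cast
      congr 2
      ring
    have hL : ∫ ξ, 𝓕 (fun ξ => (g n ξ : ℂ)) ξ • (iterConv a 1 ξ : ℂ)
        = ∫ ξ, (g n ξ : ℂ) • 𝓕 (fun x => (iterConv a 1 x : ℂ)) ξ := by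
      simpa using! hflip
    simp_rw [h.fourier_iterConv, hG, smul_eq_mul, ← Complex.ofReal_mul] at hL
    rw [integral_complex_ofReal, integral_complex_ofReal, Complex.ofReal_inj] at hL
    have hgi : Integrable (fun w : EuclideanSpace ℝ (Fin d) =>
        Real.exp (-(Real.pi ^ 2 / b) * ‖w‖ ^ 2)) volume := by
      refine Integrable.of_integral_ne_zero ?_
      rw [GaussianFourier.integral_rexp_neg_mul_sq_norm (by positivity)]
      positivity
    rw [← hL]
    calc ∫ w, (Real.pi / b) ^ ((d : ℝ) / 2) * Real.exp (-(Real.pi ^ 2 / b) * ‖w‖ ^ 2)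
            * iterConv a 1 w
        ≤ ∫ w : EuclideanSpace ℝ (Fin d), (Real.pi / b) ^ ((d : ℝ) / 2)
            * Real.exp (-(Real.pi ^ 2 / b) * ‖w‖ ^ 2) * K := by
          refine integral_mono_of_nonneg (ae_of_all _ fun w => ?_)
            ((hgi.const_mul _).mul_const _) (ae_of_all _ fun w => ?_)
          · exact mul_nonneg (by positivity) (iterConv_nonneg h.nonneg _ _)
          · exact mul_le_mul_of_nonneg_left (h.iterConv_le hK _ _) (by positivity)
      _ = K := by
          rw [integral_mul_const, integral_const_mul,
            GaussianFourier.integral_rexp_neg_mul_sq_norm (by positivity),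
            finrank_euclideanSpace_fin, ← Real.mul_rpow (by positivity) (by positivity)]
          have : Real.pi / b * (Real.pi / (Real.pi ^ 2 / b)) = 1 := by field_simp
          rw [this, Real.one_rpow, one_mul]
  have hbound' : ∀ n, ∫⁻ ξ, ENNReal.ofReal (g n ξ * cosTransform a ξ ^ 2) ≤ ENNReal.ofReal K :=
    fun n => by
      have hint : Integrable (fun ξ => g n ξ * cosTransform a ξ ^ 2) volume :=
        (hgint n).mul_bdd (c := 1) (by fun_prop) (ae_of_all _ fun ξ => by
          rw [norm_pow]
          exact pow_le_one₀ (norm_nonneg _) (h.abs_cosTransform_le ξ))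
      rw [← ofReal_integral_eq_lintegral_ofReal hint (ae_of_all _ fun ξ => by positivity)]
      exact ENNReal.ofReal_le_ofReal (hbound n)
  refine ⟨by fun_prop, ?_⟩
  rw [hasFiniteIntegral_iff_ofReal (ae_of_all _ fun ξ => by positivity)]
  refine lt_of_le_of_lt ?_ (ENNReal.ofReal_lt_top (r := K))
  have hlim : ∀ ξ, Tendsto (fun n => ENNReal.ofReal (g n ξ * cosTransform a ξ ^ 2)) atTop
      (𝓝 (ENNReal.ofReal (cosTransform a ξ ^ 2))) := fun ξ => by
    refine ENNReal.tendsto_ofReal ?_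
    have h1 : Tendsto (fun n : ℕ => g n ξ) atTop (𝓝 (Real.exp (-0 * ‖ξ‖ ^ 2))) :=
      (Real.continuous_exp.tendsto _).comp
        ((tendsto_one_div_add_atTop_nhds_zero_nat (𝕜 := ℝ)).neg.mul_const _)
    simpa using h1.mul_const (cosTransform a ξ ^ 2)
  calc ∫⁻ ξ, ENNReal.ofReal (cosTransform a ξ ^ 2)
      = ∫⁻ ξ, liminf (fun n => ENNReal.ofReal (g n ξ * cosTransform a ξ ^ 2)) atTop := by
        congr with ξ; exact (hlim ξ).liminf_eq.symm
    _ ≤ liminf (fun n => ∫⁻ ξ, ENNReal.ofReal (g n ξ * cosTransform a ξ ^ 2)) atTop :=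
        lintegral_liminf_le fun n => by
          refine ENNReal.measurable_ofReal.comp (Continuous.measurable ?_)
          simp only [hg]; fun_prop
    _ ≤ ENNReal.ofReal K := by
        refine liminf_le_of_frequently_le' (Frequently.of_forall hbound')

open FourierTransform in
theorem IsJumpKernel.iterConv_succ_eq_integral (h : IsJumpKernel a) (n : ℕ)
    (x : EuclideanSpace ℝ (Fin d)) :
    iterConv a (n + 1) x
      = ∫ ξ, Real.cos (2 * Real.pi * inner ℝ ξ x) * cosTransform a ξ ^ (n + 2) := by
  have hpow : Integrable (fun ξ => cosTransform a ξ ^ (n + 2)) volume := by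
    refine h.integrable_cosTransform_sq.mono'
      ((continuous_cosTransform h.integrable).pow _).aestronglyMeasurable (ae_of_all _ fun ξ => ?_)
    rw [norm_pow, ← sq_abs (cosTransform a ξ), Real.norm_eq_abs]
    exact pow_le_pow_of_le_one (abs_nonneg _) (h.abs_cosTransform_le ξ) (by omega)
  have hF : 𝓕 (fun x => (iterConv a (n + 1) x : ℂ))
      = fun ξ => ((cosTransform a ξ ^ (n + 2) : ℝ) : ℂ) :=
    funext fun ξ => h.fourier_iterConv (n + 1) ξ
  have hinv := Continuous.fourierInv_fourier_eq
    (Complex.continuous_ofReal.comp (h.continuous_iterConv_succ n))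
    (integrable_iterConv h.integrable (n + 1)).ofReal (by
      rw [show (Complex.ofReal ∘ iterConv a (n + 1)) = fun x => (iterConv a (n + 1) x : ℂ) from rfl,
        hF]
      exact hpow.ofReal)
  have hx := congrFun hinv x
  rw [show (Complex.ofReal ∘ iterConv a (n + 1)) = fun x => (iterConv a (n + 1) x : ℂ) from rfl,
    hF, Real.fourierInv_eq'] at hx
  have hre := congrArg Complex.re hx
  simp only [Complex.ofReal_re] at hre
  rw [← hre, ← RCLike.re_to_complex, ← integral_re]
  · congr with ξ
    rw [RCLike.re_to_complex, smul_eq_mul, Complex.re_mul_ofReal, Complex.exp_ofReal_mul_I_re]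
  · refine (hpow.ofReal (𝕜 := ℂ)).bdd_mul (c := 1) (by fun_prop) (ae_of_all _ fun ξ => ?_)
    rw [Complex.norm_exp_ofReal_mul_I]

/-! ### The covariance matrix -/

theorem integrable_coord_mul_coord (ha : Integrable a volume)
    (h2 : Integrable (fun x => ‖x‖ ^ 2 * a x) volume) (i j : Fin d) :
    Integrable (fun x => x i * x j * a x) volume := by
  refine h2.mono (AEStronglyMeasurable.mul (by fun_prop) ha.aestronglyMeasurable)
    (ae_of_all _ fun x => ?_)
  rw [norm_mul, norm_mul, norm_mul, norm_pow, norm_norm, sq]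
  gcongr
  · exact PiLp.norm_apply_le x i
  · exact PiLp.norm_apply_le x j

theorem dotProduct_covMatrix_mulVec (ha : Integrable a volume)
    (h2 : Integrable (fun x => ‖x‖ ^ 2 * a x) volume) (η : EuclideanSpace ℝ (Fin d)) :
    η.ofLp ⬝ᵥ (covMatrix a *ᵥ η.ofLp) = ∫ x, inner ℝ x η ^ 2 * a x := by
  have hpt : ∀ x : EuclideanSpace ℝ (Fin d), inner ℝ x η ^ 2 * a x
      = ∑ i, ∑ j, η i * η j * (x i * x j * a x) := fun x => by
    rw [PiLp.inner_apply, sq, Finset.sum_mul_sum, Finset.sum_mul]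
    refine Finset.sum_congr rfl fun i _ => ?_
    rw [Finset.sum_mul]
    refine Finset.sum_congr rfl fun j _ => ?_
    simp only [RCLike.inner_apply, conj_trivial]
    ring
  simp_rw [hpt]
  rw [integral_finsetSum _ fun i _ => integrable_finsetSum _ fun j _ =>
    (integrable_coord_mul_coord ha h2 i j).const_mul _]
  refine Finset.sum_congr rfl fun i _ => ?_
  rw [integral_finsetSum _ fun j _ => (integrable_coord_mul_coord ha h2 i j).const_mul _,
    Matrix.mulVec, dotProduct, Finset.mul_sum]
  refine Finset.sum_congr rfl fun j _ => ?_
  rw [integral_const_mul, covMatrix, Matrix.of_apply]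
  ring

theorem integrable_inner_sq_mul (ha : Integrable a volume)
    (h2 : Integrable (fun x => ‖x‖ ^ 2 * a x) volume) (η : EuclideanSpace ℝ (Fin d)) :
    Integrable (fun x => inner ℝ x η ^ 2 * a x) volume := by
  refine (h2.const_mul (‖η‖ ^ 2)).mono
    (AEStronglyMeasurable.mul (by fun_prop) ha.aestronglyMeasurable) (ae_of_all _ fun x => ?_)
  rw [← mul_assoc, ← mul_pow, norm_mul, norm_mul, norm_pow, norm_pow, norm_mul, norm_norm,
    norm_norm, mul_comm ‖η‖]
  gcongr
  exact norm_inner_le_norm x η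

theorem IsJumpKernel.one_sub_cosTransform_le (h : IsJumpKernel a)
    (h2 : Integrable (fun x => ‖x‖ ^ 2 * a x) volume) (ξ : EuclideanSpace ℝ (Fin d)) :
    1 - cosTransform a ξ ≤ 2 * Real.pi ^ 2 * ∫ x, inner ℝ x ξ ^ 2 * a x := by
  rw [h.one_sub_cosTransform, ← integral_const_mul]
  refine integral_mono_of_nonneg (ae_of_all _ fun x => mul_nonneg
    (sub_nonneg.2 (Real.cos_le_one _)) (h.nonneg x))
    ((integrable_inner_sq_mul h.integrable h2 ξ).const_mul _) (ae_of_all _ fun x => ?_)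
  have := mul_le_mul_of_nonneg_right
    (Real.one_sub_sq_div_two_le_cos (x := 2 * Real.pi * inner ℝ x ξ)) (h.nonneg x)
  dsimp only
  linarith

/-- The variance in direction `ξ` dominates `‖ξ‖ ^ 2`; by homogeneity it is enough to compare with
the behaviour of the characteristic function near the origin. -/
theorem IsJumpKernel.le_integral_inner_sq (h : IsJumpKernel a)
    (h2 : Integrable (fun x => ‖x‖ ^ 2 * a x) volume) {R κ : ℝ} (hR : 0 < R)
    (hκ : ∀ ξ, ‖ξ‖ ≤ R → κ * ‖ξ‖ ^ 2 ≤ 1 - cosTransform a ξ) (ξ : EuclideanSpace ℝ (Fin d)) :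
    κ * ‖ξ‖ ^ 2 ≤ 2 * Real.pi ^ 2 * ∫ x, inner ℝ x ξ ^ 2 * a x := by
  set s : ℝ := R / (‖ξ‖ + 1) with hs
  have hspos : 0 < s := by positivity
  have hle : ‖s • ξ‖ ≤ R := by
    rw [norm_smul, Real.norm_of_nonneg hspos.le, hs, div_mul_eq_mul_div,
      div_le_iff₀ (by positivity)]
    nlinarith [norm_nonneg ξ]
  have h3 := (hκ _ hle).trans (h.one_sub_cosTransform_le h2 _)
  have h4 : ∫ x, inner ℝ x (s • ξ) ^ 2 * a x = s ^ 2 * ∫ x, inner ℝ x ξ ^ 2 * a x := by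
    rw [← integral_const_mul]
    congr with x
    rw [inner_smul_right]; ring
  rw [h4, norm_smul, Real.norm_of_nonneg hspos.le, mul_pow] at h3
  refine le_of_mul_le_mul_left ?_ (by positivity : 0 < s ^ 2)
  linarith

open scoped MatrixOrder in
/-- Factorization of the covariance: `σ = BᵀB` with `B` invertible gives operators `T = B` and
`S = (B⁻¹)ᵀ` for which `‖T η‖² = (σ η, η)`, `‖S x‖² = (σ⁻¹ x, x)` and `⟪S x, T η⟫ = ⟪x, η⟫`. -/
theorem IsJumpKernel.exists_covariance_factor (h : IsJumpKernel a)
    (h2 : Integrable (fun x => ‖x‖ ^ 2 * a x) volume) :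
    ∃ T S : EuclideanSpace ℝ (Fin d) →L[ℝ] EuclideanSpace ℝ (Fin d),
      (∀ η, ‖T η‖ ^ 2 = ∫ x, inner ℝ x η ^ 2 * a x) ∧
      (∀ x, invCovForm a x = ‖S x‖ ^ 2) ∧
      (∀ x η, inner ℝ (S x) (T η) = inner ℝ x η) ∧
      LinearMap.det (T : EuclideanSpace ℝ (Fin d) →ₗ[ℝ] EuclideanSpace ℝ (Fin d)) ^ 2
        = (covMatrix a).det ∧
      LinearMap.det (T : EuclideanSpace ℝ (Fin d) →ₗ[ℝ] EuclideanSpace ℝ (Fin d)) ≠ 0 := by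
  obtain ⟨R, κ, hR, hκ, hnear, -⟩ := h.exists_one_sub_cosTransform_ge
  have hsymm : (covMatrix a).IsHermitian := by
    ext i j
    simp only [covMatrix, Matrix.conjTranspose_apply, Matrix.of_apply, star_trivial]
    congr with x; ring
  have hpos : (covMatrix a).PosDef := by
    refine Matrix.PosDef.of_dotProduct_mulVec_pos hsymm fun x hx => ?_
    have h3 := h.le_integral_inner_sq h2 hR hnear (WithLp.toLp 2 x)
    rw [← dotProduct_covMatrix_mulVec h.integrable h2] at h3
    have h4 : 0 < ‖WithLp.toLp 2 x‖ := by
      rw [norm_pos_iff]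
      intro h0
      exact hx (by simpa using congrArg WithLp.ofLp h0)
    have h5 : 0 < κ * ‖WithLp.toLp 2 x‖ ^ 2 := by positivity
    rw [star_trivial]
    exact pos_of_mul_pos_right (h5.trans_le h3) (by positivity)
  obtain ⟨B, hB⟩ := CStarAlgebra.nonneg_iff_eq_star_mul_self.1 hpos.posSemidef.nonneg
  rw [Matrix.star_eq_conjTranspose, Matrix.conjTranspose_eq_transpose_of_trivial] at hB
  have hdet : B.det ^ 2 = (covMatrix a).det := by
    rw [hB, Matrix.det_mul, Matrix.det_transpose, sq]
  have hdet0 : B.det ≠ 0 := fun h0 => by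
    have := hpos.det_pos
    rw [← hdet, h0] at this
    simp at this
  have hunit : IsUnit B.det := isUnit_iff_ne_zero.2 hdet0
  have hTdet : LinearMap.det ((Matrix.toEuclideanCLM (𝕜 := ℝ) B :
      EuclideanSpace ℝ (Fin d) →L[ℝ] EuclideanSpace ℝ (Fin d)) :
      EuclideanSpace ℝ (Fin d) →ₗ[ℝ] EuclideanSpace ℝ (Fin d)) = B.det := by
    have : ((Matrix.toEuclideanCLM (𝕜 := ℝ) B :
        EuclideanSpace ℝ (Fin d) →L[ℝ] EuclideanSpace ℝ (Fin d)) :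
        EuclideanSpace ℝ (Fin d) →ₗ[ℝ] EuclideanSpace ℝ (Fin d)) =
        Matrix.toLin (PiLp.basisFun 2 ℝ (Fin d)) (PiLp.basisFun 2 ℝ (Fin d)) B := by
      rw [← Matrix.toLpLin_eq_toLin]; rfl
    rw [this, LinearMap.det_toLin]
  have hinner : ∀ (M N : Matrix (Fin d) (Fin d) ℝ) (x y : EuclideanSpace ℝ (Fin d)),
      inner ℝ (Matrix.toEuclideanCLM (𝕜 := ℝ) M x) (Matrix.toEuclideanCLM (𝕜 := ℝ) N y)
        = x.ofLp ⬝ᵥ ((Mᵀ * N) *ᵥ y.ofLp) := fun M N x y => by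
    rw [Matrix.inner_toEuclideanCLM, Matrix.ofLp_toEuclideanCLM, ← Matrix.mulVec_mulVec,
      Matrix.dotProduct_mulVec x.ofLp, Matrix.vecMul_transpose]
  refine ⟨Matrix.toEuclideanCLM (𝕜 := ℝ) B, Matrix.toEuclideanCLM (𝕜 := ℝ) (B⁻¹)ᵀ,
    fun η => ?_, fun x => ?_, fun x η => ?_, ?_, ?_⟩
  · rw [← real_inner_self_eq_norm_sq, hinner, ← hB, dotProduct_covMatrix_mulVec h.integrable h2]
  · rw [← real_inner_self_eq_norm_sq, hinner, invCovForm, hB, Matrix.mul_inv_rev,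
      Matrix.transpose_transpose, Matrix.transpose_nonsing_inv, dotProduct_comm]
  · rw [hinner, Matrix.transpose_transpose, Matrix.nonsing_inv_mul _ hunit, Matrix.one_mulVec,
      real_inner_comm, EuclideanSpace.inner_eq_star_dotProduct]
    simp
  · rw [hTdet, hdet]
  · rwa [hTdet]

/-- Fourier representation of the centred Gaussian density with covariance `σ`, the square root
of `σ` being eliminated by the linear change of variables `T`. -/
theorem integral_cos_mul_exp_neg_norm_sq
    {T S : EuclideanSpace ℝ (Fin d) →L[ℝ] EuclideanSpace ℝ (Fin d)}
    (hTS : ∀ x η, inner ℝ (S x) (T η) = inner ℝ x η)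
    (hdet : LinearMap.det (T : EuclideanSpace ℝ (Fin d) →ₗ[ℝ] EuclideanSpace ℝ (Fin d)) ^ 2
        = (covMatrix a).det)
    (hdet0 : LinearMap.det (T : EuclideanSpace ℝ (Fin d) →ₗ[ℝ] EuclideanSpace ℝ (Fin d)) ≠ 0)
    (y : EuclideanSpace ℝ (Fin d)) :
    ∫ η, Real.cos (2 * Real.pi * inner ℝ η y) * Real.exp (-(2 * Real.pi ^ 2) * ‖T η‖ ^ 2)
      = gaussConst a * Real.exp (-(‖S y‖ ^ 2 / 2)) := by
  set D := LinearMap.det (T : EuclideanSpace ℝ (Fin d) →ₗ[ℝ] EuclideanSpace ℝ (Fin d)) with hD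
  set F : EuclideanSpace ℝ (Fin d) → ℝ := fun ζ =>
    Real.cos (2 * Real.pi * inner ℝ (S y) ζ) * Real.exp (-(2 * Real.pi ^ 2) * ‖ζ‖ ^ 2) with hF
  have h1 : (fun η => Real.cos (2 * Real.pi * inner ℝ η y)
      * Real.exp (-(2 * Real.pi ^ 2) * ‖T η‖ ^ 2)) = fun η => F (T η) := by
    funext η
    rw [hF]
    dsimp only
    rw [hTS, real_inner_comm]
  have hmap : Measure.map T volume = ENNReal.ofReal |D⁻¹| • volume :=
    Measure.map_linearMap_addHaar_eq_smul_addHaar volume hdet0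
  have hFc : Continuous F := by fun_prop
  have h2 : ∫ η, F (T η) = |D|⁻¹ * ∫ ζ, F ζ := by
    rw [← integral_map (T.continuous.aemeasurable) hFc.aestronglyMeasurable, hmap,
      integral_smul_measure, ENNReal.toReal_ofReal (abs_nonneg _), abs_inv, smul_eq_mul]
  have h3 : ∫ ζ, F ζ = (2 * Real.pi) ^ (-(d : ℝ) / 2) * Real.exp (-(‖S y‖ ^ 2 / 2)) := by
    have hb : (0 : ℝ) < 2 * Real.pi ^ 2 := by positivity
    have hg := GaussianFourier.integral_cexp_neg_mul_sq_norm_add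
      (V := EuclideanSpace ℝ (Fin d)) (b := ((2 * Real.pi ^ 2 : ℝ) : ℂ))
      (by rwa [Complex.ofReal_re]) (2 * Real.pi * Complex.I) (S y)
    have hgi := GaussianFourier.integrable_cexp_neg_mul_sq_norm_add
      (V := EuclideanSpace ℝ (Fin d)) (b := ((2 * Real.pi ^ 2 : ℝ) : ℂ))
      (by rwa [Complex.ofReal_re]) (2 * Real.pi * Complex.I) (S y)
    have hre := congrArg Complex.re hg
    rw [← RCLike.re_to_complex, ← integral_re hgi] at hre
    have hpt : ∀ ζ : EuclideanSpace ℝ (Fin d), RCLike.re (Complex.exp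
        (-((2 * Real.pi ^ 2 : ℝ) : ℂ) * (‖ζ‖ : ℂ) ^ 2
          + 2 * Real.pi * Complex.I * ((inner ℝ (S y) ζ : ℝ) : ℂ))) = F ζ := fun ζ => by
      have hc : -((2 * Real.pi ^ 2 : ℝ) : ℂ) * (‖ζ‖ : ℂ) ^ 2
          + 2 * Real.pi * Complex.I * ((inner ℝ (S y) ζ : ℝ) : ℂ)
          = ((-(2 * Real.pi ^ 2) * ‖ζ‖ ^ 2 : ℝ) : ℂ)
            + ((2 * Real.pi * inner ℝ (S y) ζ : ℝ) : ℂ) * Complex.I := by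
        push_cast; ring
      rw [RCLike.re_to_complex, hc, Complex.exp_add, ← Complex.ofReal_exp, Complex.re_ofReal_mul,
        Complex.exp_ofReal_mul_I_re, mul_comm]
    simp_rw [hpt] at hre
    rw [hre]
    have hpi : (Real.pi : ℂ) ≠ 0 := Complex.ofReal_ne_zero.2 Real.pi_ne_zero
    have hc1 : (Real.pi : ℂ) / ((2 * Real.pi ^ 2 : ℝ) : ℂ) = (((2 * Real.pi)⁻¹ : ℝ) : ℂ) := by
      push_cast
      field_simp
    have hc2 : (2 * (Real.pi : ℂ) * Complex.I) ^ 2 * (‖S y‖ : ℂ) ^ 2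
        / (4 * ((2 * Real.pi ^ 2 : ℝ) : ℂ)) = ((-(‖S y‖ ^ 2 / 2) : ℝ) : ℂ) := by
      rw [mul_pow, mul_pow, Complex.I_sq]
      push_cast
      field_simp
      ring
    have hc3 : ((Module.finrank ℝ (EuclideanSpace ℝ (Fin d)) : ℕ) : ℂ) / 2
        = (((d : ℝ) / 2 : ℝ) : ℂ) := by
      rw [finrank_euclideanSpace_fin]; push_cast; rfl
    rw [hc1, hc2, hc3, ← Complex.ofReal_cpow (by positivity), ← Complex.ofReal_exp,
      ← Complex.ofReal_mul, Complex.ofReal_re, Real.inv_rpow (by positivity), neg_div,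
      Real.rpow_neg (by positivity)]
  rw [h1, h2, h3, gaussConst, ← hdet]
  have h4 : |D ^ 2| ^ (-(1 : ℝ) / 2) = |D|⁻¹ := by
    rw [abs_pow, ← Real.rpow_natCast, ← Real.rpow_mul (abs_nonneg _), ← Real.rpow_neg_one]
    norm_num
  rw [h4]; ring

/-! ### Fourier representation of the heat kernel -/

theorem Real.hasSum_pow_div_factorial (u : ℝ) :
    HasSum (fun n : ℕ => u ^ n / (n ! : ℝ)) (Real.exp u) := by
  rw [Real.exp_eq_exp_ℝ]
  exact NormedSpace.expSeries_div_hasSum_exp u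

theorem Real.hasSum_pow_add_two_div_factorial (u : ℝ) :
    HasSum (fun n : ℕ => u ^ (n + 2) / ((n + 2)! : ℝ)) (Real.exp u - 1 - u) := by
  have h := (hasSum_nat_add_iff' 2).2 (Real.hasSum_pow_div_factorial u)
  simpa [Finset.sum_range_succ, sub_sub] using h

theorem Real.exp_sub_one_sub_le (u : ℝ) :
    Real.exp u - 1 - u ≤ u ^ 2 * Real.exp (max u 0) := by
  rcases le_total 0 u with hu | hu
  · rw [max_eq_left hu]
    have h1 : 1 - u ≤ Real.exp (-u) := by linarith [Real.add_one_le_exp (-u)]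
    have h2 : Real.exp u * Real.exp (-u) = 1 := by rw [← Real.exp_add]; simp
    have h3 : Real.exp u - 1 ≤ u * Real.exp u := by
      nlinarith [mul_le_mul_of_nonneg_left h1 (Real.exp_pos u).le]
    nlinarith [mul_le_mul_of_nonneg_left h3 hu]
  · rw [max_eq_right hu, Real.exp_zero, mul_one]
    rcases le_total (-1) u with hu1 | hu1
    · exact (le_abs_self _).trans
        (Real.abs_exp_sub_one_sub_id_le (abs_le.2 ⟨hu1, by linarith⟩))
    · have : Real.exp u ≤ 1 := Real.exp_le_one_iff.2 hu
      nlinarith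

theorem IsJumpKernel.summable_heat (h : IsJumpKernel a) (x : EuclideanSpace ℝ (Fin d)) (t : ℝ) :
    Summable (fun n : ℕ => t ^ (n + 1) * iterConv a n x / ((n + 1)! : ℝ)) := by
  obtain ⟨K, hK⟩ := h.bdd
  have hs := ((summable_nat_add_iff 1).2 (Real.hasSum_pow_div_factorial |t|).summable).mul_right K
  refine Summable.of_norm_bounded hs fun n => ?_
  rw [norm_div, norm_mul, norm_pow, Real.norm_of_nonneg (iterConv_nonneg h.nonneg _ _),
    Real.norm_natCast, Real.norm_eq_abs, mul_div_right_comm]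
  exact mul_le_mul_of_nonneg_left (h.iterConv_le hK _ _) (by positivity)

/-- The Fourier transform of `heatKernelReg a · t` without its first, possibly discontinuous,
summand `e^{-t} t a`. -/
noncomputable def heatSymbol (a : EuclideanSpace ℝ (Fin d) → ℝ) (t : ℝ)
    (ξ : EuclideanSpace ℝ (Fin d)) : ℝ :=
  Real.exp (-t) * (Real.exp (t * cosTransform a ξ) - 1 - t * cosTransform a ξ)

theorem continuous_heatSymbol (ha : Integrable a volume) (t : ℝ) :
    Continuous (heatSymbol a t) := by
  have := continuous_cosTransform ha
  unfold heatSymbol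
  fun_prop

theorem heatSymbol_nonneg (t : ℝ) (ξ : EuclideanSpace ℝ (Fin d)) : 0 ≤ heatSymbol a t ξ :=
  mul_nonneg (Real.exp_pos _).le (by linarith [Real.add_one_le_exp (t * cosTransform a ξ)])

theorem heatSymbol_le {t m : ℝ} (ht : 0 ≤ t) (hm : 0 ≤ m) {ξ : EuclideanSpace ℝ (Fin d)}
    (hξ : cosTransform a ξ ≤ m) :
    heatSymbol a t ξ ≤ t ^ 2 * Real.exp (-(1 - m) * t) * cosTransform a ξ ^ 2 := by
  have h1 := Real.exp_sub_one_sub_le (t * cosTransform a ξ)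
  have h2 : Real.exp (max (t * cosTransform a ξ) 0) ≤ Real.exp (t * m) :=
    Real.exp_le_exp.2 (max_le (mul_le_mul_of_nonneg_left hξ ht) (mul_nonneg ht hm))
  calc heatSymbol a t ξ
      ≤ Real.exp (-t) * ((t * cosTransform a ξ) ^ 2 * Real.exp (t * m)) :=
        mul_le_mul_of_nonneg_left
          (h1.trans (mul_le_mul_of_nonneg_left h2 (sq_nonneg _))) (Real.exp_pos _).le
    _ = t ^ 2 * Real.exp (-(1 - m) * t) * cosTransform a ξ ^ 2 := by
        rw [show -(1 - m) * t = -t + t * m by ring, Real.exp_add]; ring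

theorem IsJumpKernel.integrable_heatSymbol (h : IsJumpKernel a) {t : ℝ} (ht : 0 ≤ t) :
    Integrable (heatSymbol a t) volume :=
  (h.integrable_cosTransform_sq.const_mul _).mono'
    (continuous_heatSymbol h.integrable t).aestronglyMeasurable (ae_of_all _ fun ξ => by
      rw [Real.norm_of_nonneg (heatSymbol_nonneg t ξ)]
      exact heatSymbol_le ht zero_le_one (abs_le.1 (h.abs_cosTransform_le ξ)).2)

theorem IsJumpKernel.heatKernelReg_eq (h : IsJumpKernel a) (x : EuclideanSpace ℝ (Fin d)) (t : ℝ) :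
    heatKernelReg a x t = Real.exp (-t) * t * a x
      + ∫ ξ, Real.cos (2 * Real.pi * inner ℝ ξ x) * heatSymbol a t ξ := by
  set F : ℕ → EuclideanSpace ℝ (Fin d) → ℝ := fun n ξ =>
    Real.cos (2 * Real.pi * inner ℝ ξ x) * ((t * cosTransform a ξ) ^ (n + 2) / ((n + 2)! : ℝ))
    with hF
  have hcont := continuous_cosTransform h.integrable
  have hFb : ∀ n ξ, ‖F n ξ‖ ≤ |t| ^ (n + 2) / ((n + 2)! : ℝ) * cosTransform a ξ ^ 2 := fun n ξ => by
    have h1 : |cosTransform a ξ| ^ (n + 2) ≤ cosTransform a ξ ^ 2 := by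
      rw [← sq_abs (cosTransform a ξ)]
      exact pow_le_pow_of_le_one (abs_nonneg _) (h.abs_cosTransform_le ξ) (by omega)
    rw [hF]
    dsimp only
    rw [norm_mul, norm_div, norm_pow, Real.norm_natCast, norm_mul, Real.norm_eq_abs,
      Real.norm_eq_abs, Real.norm_eq_abs, mul_pow, mul_div_right_comm]
    calc |Real.cos (2 * Real.pi * inner ℝ ξ x)|
          * (|t| ^ (n + 2) / ((n + 2)! : ℝ) * |cosTransform a ξ| ^ (n + 2))
        ≤ 1 * (|t| ^ (n + 2) / ((n + 2)! : ℝ) * cosTransform a ξ ^ 2) := by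
          gcongr
          exact Real.abs_cos_le_one _
      _ = _ := one_mul _
  have hFi : ∀ n, Integrable (F n) volume := fun n =>
    (h.integrable_cosTransform_sq.const_mul _).mono'
      (by simp only [hF]; fun_prop) (ae_of_all _ (hFb n))
  have hsum : Summable fun n => ∫ ξ, ‖F n ξ‖ := by
    refine Summable.of_nonneg_of_le (fun n => integral_nonneg fun ξ => norm_nonneg _) (fun n => ?_)
      (((summable_nat_add_iff 2).2 (Real.hasSum_pow_div_factorial |t|).summable).mul_right
        (∫ ξ, cosTransform a ξ ^ 2))
    rw [← integral_const_mul]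
    exact integral_mono (hFi n).norm (h.integrable_cosTransform_sq.const_mul _) (hFb n)
  have htsum := integral_tsum_of_summable_integral_norm hFi hsum
  have hterm : ∀ n, ∫ ξ, F n ξ = t ^ (n + 2) * iterConv a (n + 1) x / ((n + 2)! : ℝ) := fun n => by
    rw [h.iterConv_succ_eq_integral, mul_div_right_comm, ← integral_const_mul]
    congr with ξ
    simp only [hF]; ring
  have hpt : ∀ ξ, ∑' n, F n ξ = Real.cos (2 * Real.pi * inner ℝ ξ x)
      * (Real.exp (t * cosTransform a ξ) - 1 - t * cosTransform a ξ) := fun ξ =>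
    ((Real.hasSum_pow_add_two_div_factorial _).mul_left _).tsum_eq
  simp_rw [hterm, hpt] at htsum
  have hint : ∫ ξ, Real.cos (2 * Real.pi * inner ℝ ξ x) * heatSymbol a t ξ
      = Real.exp (-t) * ∑' n : ℕ, t ^ (n + 2) * iterConv a (n + 1) x / ((n + 2)! : ℝ) := by
    rw [htsum, ← integral_const_mul]
    congr with ξ
    simp only [heatSymbol]; ring
  rw [hint, heatKernelReg, (h.summable_heat x t).tsum_eq_zero_add]
  simp [iterConv]
  ring

/-! ### The local limit theorem -/

theorem tendsto_mul_one_sub_cos (u : ℝ) :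
    Tendsto (fun t : ℝ => t * (1 - Real.cos ((√t)⁻¹ * u))) atTop (𝓝 (u ^ 2 / 2)) := by
  have h0 : Tendsto (fun t : ℝ => (√t)⁻¹ * u / 2) atTop (𝓝 0) := by
    have := (tendsto_inv_atTop_zero.comp Real.tendsto_sqrt_atTop).mul_const (u / 2)
    simpa [mul_div_assoc] using this
  have h1 := ((Real.continuous_sinc.tendsto 0).comp h0).pow 2
  have h2 := h1.const_mul (u ^ 2 / 2)
  rw [Real.sinc_zero, one_pow, mul_one] at h2
  refine h2.congr' ?_
  filter_upwards [eventually_gt_atTop 0] with t ht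
  have hs : (√t)⁻¹ ^ 2 * t = 1 := by
    rw [inv_pow, Real.sq_sqrt ht.le, inv_mul_cancel₀ ht.ne']
  set v := (√t)⁻¹ * u / 2 with hv
  have hcos : Real.cos ((√t)⁻¹ * u) = 1 - 2 * Real.sin v ^ 2 := by
    rw [show (√t)⁻¹ * u = 2 * v by rw [hv]; ring, Real.cos_two_mul, Real.cos_sq']; ring
  have hsin : Real.sin v = v * Real.sinc v := by
    rcases eq_or_ne v 0 with h0 | h0
    · simp [h0]
    · rw [Real.sinc_of_ne_zero h0]; field_simp
  simp only [Function.comp_apply]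
  rw [hcos, hsin, ← hv, hv]
  linear_combination (-(u ^ 2 / 2) * Real.sinc ((√t)⁻¹ * u / 2) ^ 2) * hs

theorem IsJumpKernel.tendsto_mul_one_sub_cosTransform (h : IsJumpKernel a)
    (h2 : Integrable (fun x => ‖x‖ ^ 2 * a x) volume) (η : EuclideanSpace ℝ (Fin d)) :
    Tendsto (fun t : ℝ => t * (1 - cosTransform a ((√t)⁻¹ • η))) atTop
      (𝓝 (2 * Real.pi ^ 2 * ∫ x, inner ℝ x η ^ 2 * a x)) := by
  rw [← integral_const_mul]
  simp_rw [h.one_sub_cosTransform, ← integral_const_mul]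
  refine tendsto_integral_filter_of_dominated_convergence
    (fun x => 2 * Real.pi ^ 2 * (inner ℝ x η ^ 2 * a x)) ?_ ?_
    ((integrable_inner_sq_mul h.integrable h2 η).const_mul _) (ae_of_all _ fun x => ?_)
  · exact Eventually.of_forall fun t => AEStronglyMeasurable.const_mul
      (AEStronglyMeasurable.mul (by fun_prop) h.integrable.aestronglyMeasurable) _
  · filter_upwards [eventually_gt_atTop 0] with t ht
    refine ae_of_all _ fun x => ?_
    rw [Real.norm_of_nonneg (mul_nonneg ht.le (mul_nonneg
      (sub_nonneg.2 (Real.cos_le_one _)) (h.nonneg x)))]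
    have h3 := mul_le_mul_of_nonneg_left (mul_le_mul_of_nonneg_right
      (Real.one_sub_sq_div_two_le_cos (x := 2 * Real.pi * inner ℝ x ((√t)⁻¹ • η))) (h.nonneg x))
      ht.le
    rw [inner_smul_right] at h3 ⊢
    have hs : (√t)⁻¹ ^ 2 * t = 1 := by
      rw [inv_pow, Real.sq_sqrt ht.le, inv_mul_cancel₀ ht.ne']
    linear_combination h3 + (2 * Real.pi ^ 2 * inner ℝ x η ^ 2 * a x) * hs
  · have h3 := (tendsto_mul_one_sub_cos (2 * Real.pi * inner ℝ x η)).mul_const (a x)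
    convert h3 using 2 with t
    · rw [inner_smul_right, ← mul_assoc, show 2 * Real.pi * ((√t)⁻¹ * inner ℝ x η)
        = (√t)⁻¹ * (2 * Real.pi * inner ℝ x η) by ring]
    · ring

theorem sqrt_inv_pow_inv_abs {t : ℝ} (ht : 0 < t) (d : ℕ) :
    |((√t)⁻¹ ^ d)⁻¹| = t ^ ((d : ℝ) / 2) := by
  rw [inv_pow, inv_inv, abs_of_nonneg (by positivity), Real.sqrt_eq_rpow, ← Real.rpow_natCast,
    ← Real.rpow_mul ht.le]
  congr 1; ring

theorem tendsto_rpow_mul_exp_neg_mul (s : ℝ) {b : ℝ} (hb : 0 < b) :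
    Tendsto (fun t : ℝ => t ^ s * Real.exp (-b * t)) atTop (𝓝 0) :=
  tendsto_rpow_mul_exp_neg_mul_atTop_nhds_zero s b hb

/-- After the diffusive rescaling of frequencies, the symbol converges in `L¹` to the Gaussian.
Inside the ball of radius `R √t` this is dominated convergence, outside of it the symbol is
exponentially small by the spectral gap. -/
theorem IsJumpKernel.tendsto_integral_heatSymbol_sub (h : IsJumpKernel a)
    (h2 : Integrable (fun x => ‖x‖ ^ 2 * a x) volume)
    {T : EuclideanSpace ℝ (Fin d) →L[ℝ] EuclideanSpace ℝ (Fin d)}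
    (hT : ∀ η, ‖T η‖ ^ 2 = ∫ x, inner ℝ x η ^ 2 * a x) :
    Integrable (fun η => Real.exp (-(2 * Real.pi ^ 2) * ‖T η‖ ^ 2)) volume ∧
    Tendsto (fun t : ℝ => ∫ η, |heatSymbol a t ((√t)⁻¹ • η)
      - Real.exp (-(2 * Real.pi ^ 2) * ‖T η‖ ^ 2)|) atTop (𝓝 0) := by
  obtain ⟨R, κ, hR, hκ, hnear, hfar⟩ := h.exists_one_sub_cosTransform_ge
  have hcont := continuous_cosTransform h.integrable
  have hgκ : Integrable (fun η : EuclideanSpace ℝ (Fin d) => Real.exp (-κ * ‖η‖ ^ 2)) volume := by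
    refine Integrable.of_integral_ne_zero ?_
    rw [GaussianFourier.integral_rexp_neg_mul_sq_norm hκ]
    positivity
  set G : EuclideanSpace ℝ (Fin d) → ℝ := fun η => Real.exp (-(2 * Real.pi ^ 2) * ‖T η‖ ^ 2) with hG
  have hGle : ∀ η, G η ≤ Real.exp (-κ * ‖η‖ ^ 2) := fun η => by
    refine Real.exp_le_exp.2 ?_
    have := h.le_integral_inner_sq h2 hR hnear η
    rw [← hT] at this
    linarith
  have hGc : Continuous G := by fun_prop
  have hGi : Integrable G volume := hgκ.mono' hGc.aestronglyMeasurable (ae_of_all _ fun η => by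
    rw [Real.norm_of_nonneg (Real.exp_pos _).le]; exact hGle η)
  refine ⟨hGi, ?_⟩
  set B : Set (EuclideanSpace ℝ (Fin d)) := Metric.closedBall 0 R with hB
  have hBm : MeasurableSet B := Metric.isClosed_closedBall.measurableSet
  set P : ℝ → EuclideanSpace ℝ (Fin d) → ℝ := fun t =>
    B.indicator fun ξ => Real.exp (-(t * (1 - cosTransform a ξ))) with hP
  have hPm : ∀ t, Measurable (P t) := fun t =>
    Measurable.indicator (Continuous.measurable (by fun_prop)) hBm
  have hPin : ∀ t ξ, ξ ∈ B → P t ξ = Real.exp (-(t * (1 - cosTransform a ξ))) :=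
    fun t ξ hm => Set.indicator_of_mem hm _
  have hPout : ∀ t ξ, ξ ∉ B → P t ξ = 0 := fun t ξ hm => Set.indicator_of_notMem hm _
  have hPb : ∀ t : ℝ, 0 < t → ∀ η, |P t ((√t)⁻¹ • η)| ≤ Real.exp (-κ * ‖η‖ ^ 2) := fun t ht η => by
    by_cases hm : (√t)⁻¹ • η ∈ B
    · rw [hPin _ _ hm, abs_of_pos (Real.exp_pos _)]
      refine Real.exp_le_exp.2 ?_
      have h3 := mul_le_mul_of_nonneg_left (hnear _ (by simpa [hB] using hm)) ht.le
      rw [norm_smul, mul_pow, norm_inv, inv_pow, Real.norm_of_nonneg (Real.sqrt_nonneg t),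
        Real.sq_sqrt ht.le] at h3
      have h4 : t * (κ * (t⁻¹ * ‖η‖ ^ 2)) = κ * ‖η‖ ^ 2 := by field_simp
      linarith
    · rw [hPout _ _ hm, abs_zero]
      exact (Real.exp_pos _).le
  have hsmul : ∀ s : ℝ, Continuous fun η : EuclideanSpace ℝ (Fin d) => s • η := fun s => by fun_prop
  have hPi : ∀ t : ℝ, 0 < t → Integrable (fun η => P t ((√t)⁻¹ • η)) volume := fun t ht =>
    hgκ.mono' ((hPm t).comp (hsmul _).measurable).aestronglyMeasurable (ae_of_all _ (hPb t ht))
  -- the main part, by dominated convergence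
  have hI1 : Tendsto (fun t : ℝ => ∫ η, |P t ((√t)⁻¹ • η) - G η|) atTop (𝓝 0) := by
    have h3 : Tendsto (fun t : ℝ => ∫ η, |P t ((√t)⁻¹ • η) - G η|) atTop
        (𝓝 (∫ _ : EuclideanSpace ℝ (Fin d), (0 : ℝ))) := by
      refine tendsto_integral_filter_of_dominated_convergence
        (fun η => Real.exp (-κ * ‖η‖ ^ 2) + Real.exp (-κ * ‖η‖ ^ 2)) ?_ ?_ (hgκ.add hgκ)
        (ae_of_all _ fun η => ?_)
      · refine Eventually.of_forall fun t => Measurable.aestronglyMeasurable ?_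
        exact (((hPm t).comp (hsmul _).measurable).sub hGc.measurable).norm
      · filter_upwards [eventually_gt_atTop 0] with t ht
        refine ae_of_all _ fun η => ?_
        rw [Real.norm_eq_abs, abs_abs]
        refine (abs_sub _ _).trans (add_le_add (hPb t ht η) ?_)
        rw [abs_of_pos (Real.exp_pos _)]
        exact hGle η
      · have h4 := (Real.continuous_exp.tendsto _).comp
          (h.tendsto_mul_one_sub_cosTransform h2 η).neg
        rw [← hT, ← neg_mul] at h4
        have h5 : Tendsto (fun t : ℝ => (√t)⁻¹ • η) atTop (𝓝 0) := by
          simpa using (tendsto_inv_atTop_zero.comp Real.tendsto_sqrt_atTop).smul_const η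
        have h6 : Tendsto (fun t : ℝ => P t ((√t)⁻¹ • η)) atTop (𝓝 (G η)) := by
          refine h4.congr' ?_
          filter_upwards [h5 (Metric.closedBall_mem_nhds 0 hR)] with t ht
          rw [hPin _ _ ht]
          rfl
        simpa using (h6.sub_const (G η)).abs
    simpa using h3
  set VB : ℝ := ∫ ξ, B.indicator (fun _ => (1 : ℝ)) ξ with hVB
  set Q : ℝ := ∫ ξ, cosTransform a ξ ^ 2 with hQ
  have hBi : Integrable (B.indicator fun _ => (1 : ℝ)) volume :=
    (integrable_indicator_iff hBm).2 (integrableOn_const (by exact measure_closedBall_lt_top.ne))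
  have hscale : ∀ (F : EuclideanSpace ℝ (Fin d) → ℝ) (t : ℝ), 0 < t →
      ∫ η, F ((√t)⁻¹ • η) = t ^ ((d : ℝ) / 2) * ∫ ξ, F ξ := fun F t ht => by
    rw [Measure.integral_comp_smul, finrank_euclideanSpace_fin, sqrt_inv_pow_inv_abs ht,
      smul_eq_mul]
  have hbound : ∀ t : ℝ, 0 < t → ∀ η, |heatSymbol a t ((√t)⁻¹ • η) - G η|
      ≤ |P t ((√t)⁻¹ • η) - G η|
        + (Real.exp (-t) * (1 + t) * B.indicator (fun _ => (1 : ℝ)) ((√t)⁻¹ • η)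
        + t ^ 2 * Real.exp (-(1 / 2) * t) * cosTransform a ((√t)⁻¹ • η) ^ 2) := fun t ht η => by
    set ξ := (√t)⁻¹ • η
    refine (abs_sub_le _ (P t ξ) _).trans ?_
    rw [add_comm]
    refine add_le_add le_rfl ?_
    by_cases hm : ξ ∈ B
    · rw [hPin _ _ hm, Set.indicator_of_mem hm]
      have h3 : heatSymbol a t ξ - Real.exp (-(t * (1 - cosTransform a ξ)))
          = -(Real.exp (-t) * (1 + t * cosTransform a ξ)) := by
        rw [heatSymbol, show -(t * (1 - cosTransform a ξ)) = -t + t * cosTransform a ξ by ring,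
          Real.exp_add]
        ring
      have h4 : |1 + t * cosTransform a ξ| ≤ 1 + t := by
        refine (abs_add_le _ _).trans ?_
        rw [abs_one, abs_mul, abs_of_pos ht]
        have := mul_le_mul_of_nonneg_left (h.abs_cosTransform_le ξ) ht.le
        linarith
      rw [h3, abs_neg, abs_mul, abs_of_pos (Real.exp_pos _), mul_one]
      refine (mul_le_mul_of_nonneg_left h4 (Real.exp_pos _).le).trans ?_
      exact le_add_of_nonneg_right (by positivity)
    · rw [hPout _ _ hm, Set.indicator_of_notMem hm, mul_zero, zero_add,
        sub_zero, abs_of_nonneg (heatSymbol_nonneg t ξ)]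
      have h3 := heatSymbol_le ht.le (by norm_num) (hfar ξ (by simpa [hB] using hm))
      norm_num at h3 ⊢
      exact h3
  have hlim : Tendsto (fun t : ℝ => (∫ η, |P t ((√t)⁻¹ • η) - G η|)
      + (VB * (t ^ ((d : ℝ) / 2) * Real.exp (-1 * t)
          + t ^ ((d : ℝ) / 2 + 1) * Real.exp (-1 * t))
        + Q * (t ^ ((d : ℝ) / 2 + 2) * Real.exp (-(1 / 2) * t)))) atTop (𝓝 0) := by
    have h3 := hI1.add (((((tendsto_rpow_mul_exp_neg_mul ((d : ℝ) / 2) one_pos).add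
      (tendsto_rpow_mul_exp_neg_mul ((d : ℝ) / 2 + 1) one_pos)).const_mul VB).add
      ((tendsto_rpow_mul_exp_neg_mul ((d : ℝ) / 2 + 2) one_half_pos).const_mul Q)))
    simpa using h3
  refine squeeze_zero' (Eventually.of_forall fun t => integral_nonneg fun η => abs_nonneg _) ?_ hlim
  filter_upwards [eventually_gt_atTop 0] with t ht
  have hs : (√t)⁻¹ ≠ 0 := inv_ne_zero (Real.sqrt_pos.2 ht).ne'
  have hi2 := (hBi.comp_smul hs).const_mul (Real.exp (-t) * (1 + t))
  have hi3 := (h.integrable_cosTransform_sq.comp_smul hs).const_mul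
    (t ^ 2 * Real.exp (-(1 / 2) * t))
  have hi1 : Integrable (fun η => |P t ((√t)⁻¹ • η) - G η|) volume := ((hPi t ht).sub hGi).abs
  refine (integral_mono_of_nonneg (ae_of_all _ fun η => abs_nonneg _)
    (hi1.add (hi2.add hi3)) (ae_of_all _ (hbound t ht))).trans_eq ?_
  rw [integral_add' hi1 (hi2.add hi3), integral_add' hi2 hi3, integral_const_mul,
    integral_const_mul, hscale (B.indicator fun _ => (1 : ℝ)) t ht,
    hscale (fun ξ => cosTransform a ξ ^ 2) t ht, Real.rpow_add ht, Real.rpow_add ht,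
    Real.rpow_one, Real.rpow_two, ← hVB, ← hQ, neg_one_mul]
  ring

/-- Uniform local limit theorem, with an additive error. -/
theorem IsJumpKernel.exists_local_limit (h : IsJumpKernel a)
    (h2 : Integrable (fun x => ‖x‖ ^ 2 * a x) volume) :
    ∃ err : ℝ → ℝ, Tendsto err atTop (𝓝 0) ∧ ∀ t : ℝ, 0 < t → ∀ x,
      |t ^ ((d : ℝ) / 2) * heatKernelReg a x t
        - gaussConst a * Real.exp (-(invCovForm a x / (2 * t)))| ≤ err t := by
  obtain ⟨T, S, hT, hS, hTS, hdet, hdet0⟩ := h.exists_covariance_factor h2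
  obtain ⟨hGi, hlim⟩ := h.tendsto_integral_heatSymbol_sub h2 hT
  obtain ⟨K, hK⟩ := h.bdd
  refine ⟨fun t => K * (t ^ ((d : ℝ) / 2 + 1) * Real.exp (-1 * t))
    + ∫ η, |heatSymbol a t ((√t)⁻¹ • η) - Real.exp (-(2 * Real.pi ^ 2) * ‖T η‖ ^ 2)|,
    by simpa using ((tendsto_rpow_mul_exp_neg_mul ((d : ℝ) / 2 + 1) one_pos).const_mul K).add hlim,
    fun t ht x => ?_⟩
  have hs : (√t)⁻¹ ≠ 0 := inv_ne_zero (Real.sqrt_pos.2 ht).ne'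
  have hHi := (h.integrable_heatSymbol ht.le).comp_smul hs
  have hscale : t ^ ((d : ℝ) / 2) * ∫ ξ, Real.cos (2 * Real.pi * inner ℝ ξ x) * heatSymbol a t ξ
      = ∫ η, Real.cos (2 * Real.pi * inner ℝ η ((√t)⁻¹ • x)) * heatSymbol a t ((√t)⁻¹ • η) := by
    rw [← sqrt_inv_pow_inv_abs ht, ← smul_eq_mul]
    nth_rw 1 [← finrank_euclideanSpace_fin (𝕜 := ℝ) (n := d)]
    rw [← Measure.integral_comp_smul volume
      (fun ξ => Real.cos (2 * Real.pi * inner ℝ ξ x) * heatSymbol a t ξ)]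
    simp_rw [real_inner_smul_left, real_inner_smul_right]
  have hgauss : gaussConst a * Real.exp (-(invCovForm a x / (2 * t)))
      = ∫ η, Real.cos (2 * Real.pi * inner ℝ η ((√t)⁻¹ • x))
        * Real.exp (-(2 * Real.pi ^ 2) * ‖T η‖ ^ 2) := by
    rw [integral_cos_mul_exp_neg_norm_sq hTS hdet hdet0, hS, map_smul, norm_smul, mul_pow,
      norm_inv, inv_pow, Real.norm_of_nonneg (Real.sqrt_nonneg t), Real.sq_sqrt ht.le]
    congr 3
    field_simp
  have hcos : ∀ F : EuclideanSpace ℝ (Fin d) → ℝ, Integrable F volume →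
      Integrable (fun η => Real.cos (2 * Real.pi * inner ℝ η ((√t)⁻¹ • x)) * F η) volume :=
    fun F hF => hF.bdd_mul (c := 1) (by fun_prop) (ae_of_all _ fun η => by
      simpa using Real.abs_cos_le_one _)
  rw [h.heatKernelReg_eq, mul_add, hscale, hgauss, add_sub_assoc,
    ← integral_sub (hcos _ hHi) (hcos _ hGi)]
  refine (abs_add_le _ _).trans (add_le_add ?_ ?_)
  · rw [abs_of_nonneg (by have := h.nonneg x; positivity), Real.rpow_add ht, Real.rpow_one,
      neg_one_mul]
    have := mul_le_mul_of_nonneg_left (hK x)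
      (by positivity : 0 ≤ t ^ ((d : ℝ) / 2) * (Real.exp (-t) * t))
    linarith
  · rw [← Real.norm_eq_abs]
    refine norm_integral_le_of_norm_le (hHi.sub hGi).abs (ae_of_all _ fun η => ?_)
    rw [← mul_sub, norm_mul]
    exact mul_le_of_le_one_left (norm_nonneg _) (Real.abs_cos_le_one _)

theorem IsJumpKernel.gaussConst_pos (h : IsJumpKernel a)
    (h2 : Integrable (fun x => ‖x‖ ^ 2 * a x) volume) : 0 < gaussConst a := by
  obtain ⟨T, S, -, -, -, hdet, hdet0⟩ := h.exists_covariance_factor h2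
  have : (covMatrix a).det ≠ 0 := hdet ▸ pow_ne_zero 2 hdet0
  unfold gaussConst
  positivity

/-- The local limit theorem with a relative error in the diffusive region, where the Gaussian is
bounded below by a multiple of `t ^ (-d / 2)`. -/
theorem IsJumpKernel.eventually_heatKernelReg_eq (h : IsJumpKernel a)
    (h2 : Integrable (fun x => ‖x‖ ^ 2 * a x) volume) {r : ℝ} {ε : ℝ} (hε : 0 < ε) :
    ∀ᶠ t : ℝ in atTop, ∀ x : EuclideanSpace ℝ (Fin d), ‖x‖ ≤ r * t ^ ((1 : ℝ) / 2) →
      ∃ η : ℝ, |η| ≤ ε ∧ heatKernelReg a x t = gaussConst a / t ^ ((d : ℝ) / 2) *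
        Real.exp (-(invCovForm a x / (2 * t))) * (1 + η) := by
  obtain ⟨T, S, -, hS, -, -, -⟩ := h.exists_covariance_factor h2
  obtain ⟨err, herr, hloc⟩ := h.exists_local_limit h2
  have hc := h.gaussConst_pos h2
  have hsmall : ∀ᶠ t in atTop, err t < ε * (gaussConst a * Real.exp (-((‖S‖ * r) ^ 2 / 2))) :=
    herr.eventually (gt_mem_nhds (by positivity))
  filter_upwards [hsmall, eventually_gt_atTop 0] with t hsm ht x hx
  rw [← Real.sqrt_eq_rpow] at hx
  have hq : invCovForm a x / (2 * t) ≤ (‖S‖ * r) ^ 2 / 2 := by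
    rw [hS, div_le_div_iff₀ (by positivity) (by positivity)]
    have h3 : ‖S x‖ ≤ ‖S‖ * (r * √t) := (S.le_opNorm x).trans (by gcongr)
    have h4 := pow_le_pow_left₀ (norm_nonneg _) h3 2
    rw [← mul_assoc, mul_pow, Real.sq_sqrt ht.le] at h4
    linarith
  have hE : gaussConst a * Real.exp (-((‖S‖ * r) ^ 2 / 2))
      ≤ gaussConst a * Real.exp (-(invCovForm a x / (2 * t))) := by
    gcongr
  set E := gaussConst a * Real.exp (-(invCovForm a x / (2 * t))) with hEdef
  have hEpos : 0 < E := by positivity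
  have htd : 0 < t ^ ((d : ℝ) / 2) := by positivity
  refine ⟨(t ^ ((d : ℝ) / 2) * heatKernelReg a x t - E) / E, ?_, ?_⟩
  · rw [abs_div, abs_of_pos hEpos, div_le_iff₀ hEpos]
    exact (hloc t ht x).trans (hsm.le.trans (mul_le_mul_of_nonneg_left hE hε.le))
  · rw [div_mul_eq_mul_div, ← hEdef]
    field_simp
    ring

/-! ### Lower bound by chaining -/

theorem sum_antidiagonal_pow_div_factorial_le {s t : ℝ} (hs : 0 ≤ s) (ht : 0 ≤ t) (k : ℕ) :
    ∑ p ∈ Finset.HasAntidiagonal.antidiagonal k,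
      s ^ (p.1 + 1) / ((p.1 + 1)! : ℝ) * (t ^ (p.2 + 1) / ((p.2 + 1)! : ℝ))
      ≤ (s + t) ^ (k + 2) / ((k + 2)! : ℝ) := by
  have hbin : (s + t) ^ (k + 2) / ((k + 2)! : ℝ) = ∑ p ∈ Finset.HasAntidiagonal.antidiagonal (k + 2),
      s ^ p.1 / (p.1 ! : ℝ) * (t ^ p.2 / (p.2 ! : ℝ)) := by
    rw [(Commute.all s t).add_pow', Finset.sum_div]
    refine Finset.sum_congr rfl fun p hp => ?_
    rw [Finset.HasAntidiagonal.mem_antidiagonal] at hp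
    rw [← hp, nsmul_eq_mul]
    have h1 : (((p.1 + p.2).choose p.1 : ℕ) : ℝ) * (p.1 ! : ℝ) * (p.2 ! : ℝ)
        = ((p.1 + p.2)! : ℝ) := by
      rw [Nat.choose_symm_add]
      exact_mod_cast Nat.add_choose_mul_factorial_mul_factorial p.1 p.2
    rw [← h1]
    have h2 : (((p.1 + p.2).choose p.1 : ℕ) : ℝ) ≠ 0 :=
      Nat.cast_ne_zero.2 (Nat.choose_pos (Nat.le_add_right _ _)).ne'
    field_simp
  rw [hbin, Finset.Nat.antidiagonal_succ_succ', Finset.sum_cons, Finset.sum_cons, Finset.sum_map]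
  have h1 : 0 ≤ s ^ 0 / (0 ! : ℝ) * (t ^ (k + 2) / ((k + 2)! : ℝ)) := by positivity
  have h2 : 0 ≤ s ^ (k + 2) / ((k + 2)! : ℝ) * (t ^ 0 / (0 ! : ℝ)) := by positivity
  exact le_add_of_nonneg_of_le h1 (le_add_of_nonneg_left h2)

/-- The heat kernel is super-convolutive in time, because `e^{-t} δ + heatKernelReg a · t` is a
convolution semigroup. Only a pointwise lower bound on the factors over a set `B` is kept. -/
theorem IsJumpKernel.mul_measureReal_le_heatKernelReg_add (h : IsJumpKernel a) {s t : ℝ}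
    (hs : 0 ≤ s) (ht : 0 ≤ t) (x : EuclideanSpace ℝ (Fin d)) {B : Set (EuclideanSpace ℝ (Fin d))}
    (hB : MeasurableSet B) (hBfin : volume B ≠ ⊤) {m : ℝ}
    (hm : ∀ y ∈ B, m ≤ heatKernelReg a y s * heatKernelReg a (x - y) t) :
    m * volume.real B ≤ heatKernelReg a x (s + t) := by
  have hnn := iterConv_nonneg h.nonneg
  set f : ℝ → ℕ → EuclideanSpace ℝ (Fin d) → ℝ := fun s n y =>
    s ^ (n + 1) * iterConv a n y / ((n + 1)! : ℝ) with hf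
  have hfnn : ∀ s, 0 ≤ s → ∀ n y, 0 ≤ f s n y := fun s hs n y =>
    div_nonneg (mul_nonneg (pow_nonneg hs _) (hnn n y)) (by positivity)
  set H : ℕ → EuclideanSpace ℝ (Fin d) → ℝ := fun k y =>
    ∑ p ∈ Finset.HasAntidiagonal.antidiagonal k, f s p.1 y * f t p.2 (x - y) with hH
  have hHnn : ∀ k y, 0 ≤ H k y := fun k y =>
    Finset.sum_nonneg fun p _ => mul_nonneg (hfnn s hs _ _) (hfnn t ht _ _)
  have hHterm : ∀ p : ℕ × ℕ, (fun y => f s p.1 y * f t p.2 (x - y)) = fun y =>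
      s ^ (p.1 + 1) / ((p.1 + 1)! : ℝ) * (t ^ (p.2 + 1) / ((p.2 + 1)! : ℝ))
        * (iterConv a p.1 y * iterConv a p.2 (x - y)) := fun p => by
    funext y; simp only [hf]; ring
  have hHi' : ∀ p : ℕ × ℕ, Integrable (fun y => f s p.1 y * f t p.2 (x - y)) volume := fun p => by
    rw [hHterm]; exact (h.integrable_mul_sub _ _ _).const_mul _
  have hHi : ∀ k, Integrable (H k) volume := fun k => integrable_finsetSum _ fun p _ => hHi' p
  have hHint : ∀ k, ∫ y, H k y ≤ f (s + t) (k + 1) x := fun k => by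
    rw [hH]
    dsimp only
    rw [integral_finsetSum _ fun p _ => hHi' p]
    calc ∑ p ∈ Finset.HasAntidiagonal.antidiagonal k, ∫ y, f s p.1 y * f t p.2 (x - y)
        = (∑ p ∈ Finset.HasAntidiagonal.antidiagonal k, s ^ (p.1 + 1) / ((p.1 + 1)! : ℝ)
            * (t ^ (p.2 + 1) / ((p.2 + 1)! : ℝ))) * iterConv a (k + 1) x := by
          rw [Finset.sum_mul]
          refine Finset.sum_congr rfl fun p hp => ?_
          rw [hHterm, integral_const_mul, h.integral_mul_sub, Finset.HasAntidiagonal.mem_antidiagonal.1 hp]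
      _ ≤ (s + t) ^ (k + 2) / ((k + 2)! : ℝ) * iterConv a (k + 1) x :=
          mul_le_mul_of_nonneg_right (sum_antidiagonal_pow_div_factorial_le hs ht k) (hnn _ _)
      _ = f (s + t) (k + 1) x := by simp only [hf]; ring
  have hsf : ∀ s y, Summable fun n => f s n y := fun s y => h.summable_heat y s
  have hCauchy : ∀ y, Summable (fun k => H k y) ∧
      heatKernelReg a y s * heatKernelReg a (x - y) t
        = Real.exp (-(s + t)) * ∑' k, H k y := fun y => by
    have h1 := (hsf s y).norm
    have h2 := (hsf t (x - y)).norm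
    refine ⟨(summable_norm_sum_mul_antidiagonal_of_summable_norm h1 h2).of_norm, ?_⟩
    rw [show ∑' k, H k y = (∑' n, f s n y) * ∑' n, f t n (x - y) from
      (tsum_mul_tsum_eq_tsum_sum_antidiagonal_of_summable_norm h1 h2).symm,
      neg_add, Real.exp_add, heatKernelReg, heatKernelReg]
    ring
  have hsf1 : Summable fun k => f (s + t) (k + 1) x := (summable_nat_add_iff 1).2 (hsf (s + t) x)
  have hst : 0 ≤ s + t := add_nonneg hs ht
  have hkey : ENNReal.ofReal (Real.exp (s + t) * m) * volume B
      ≤ ENNReal.ofReal (∑' k, f (s + t) (k + 1) x) :=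
    calc ENNReal.ofReal (Real.exp (s + t) * m) * volume B
        = ∫⁻ _ in B, ENNReal.ofReal (Real.exp (s + t) * m) := by rw [setLIntegral_const]
      _ ≤ ∫⁻ y in B, ∑' k, ENNReal.ofReal (H k y) := by
          refine setLIntegral_mono' hB fun y hy => ?_
          rw [← ENNReal.ofReal_tsum_of_nonneg (fun k => hHnn k y) (hCauchy y).1]
          refine ENNReal.ofReal_le_ofReal ?_
          have h1 := mul_le_mul_of_nonneg_left (hm y hy) (Real.exp_pos (s + t)).le
          rwa [(hCauchy y).2, ← mul_assoc, ← Real.exp_add, add_neg_cancel, Real.exp_zero,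
            one_mul] at h1
      _ ≤ ∫⁻ y, ∑' k, ENNReal.ofReal (H k y) := setLIntegral_le_lintegral _ _
      _ = ∑' k, ∫⁻ y, ENNReal.ofReal (H k y) :=
          lintegral_tsum fun k => (hHi k).aestronglyMeasurable.aemeasurable.ennreal_ofReal
      _ ≤ ∑' k, ENNReal.ofReal (f (s + t) (k + 1) x) := by
          refine ENNReal.tsum_le_tsum fun k => ?_
          rw [← ofReal_integral_eq_lintegral_ofReal (hHi k) (ae_of_all _ (hHnn k))]
          exact ENNReal.ofReal_le_ofReal (hHint k)
      _ = ENNReal.ofReal (∑' k, f (s + t) (k + 1) x) :=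
          (ENNReal.ofReal_tsum_of_nonneg (fun k => hfnn _ hst _ _) hsf1).symm
  have hkey2 : Real.exp (s + t) * m * volume.real B ≤ ∑' k, f (s + t) (k + 1) x := by
    have h1 : 0 ≤ ∑' k, f (s + t) (k + 1) x := tsum_nonneg fun k => hfnn _ hst _ _
    rw [← ENNReal.ofReal_toReal hBfin, ← ENNReal.ofReal_mul' ENNReal.toReal_nonneg] at hkey
    exact (ENNReal.ofReal_le_ofReal_iff h1).1 hkey
  have hv : heatKernelReg a x (s + t)
      = Real.exp (-(s + t)) * (f (s + t) 0 x + ∑' k, f (s + t) (k + 1) x) := by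
    rw [heatKernelReg, ← (hsf (s + t) x).tsum_eq_zero_add]
  have h0 := hfnn (s + t) hst 0 x
  rw [hv]
  calc m * volume.real B
      = Real.exp (-(s + t)) * (Real.exp (s + t) * m * volume.real B) := by
        rw [mul_assoc, ← mul_assoc, ← Real.exp_add, neg_add_cancel, Real.exp_zero, one_mul]
    _ ≤ _ := mul_le_mul_of_nonneg_left (by linarith) (Real.exp_pos _).le

/-- Chaining along the points `u, 2u, …, (n + 1)u`: if the kernel at time `τ` is at least `m` on the
ball of radius `2ρ` around `u`, then paths visiting the balls of radius `ρ` around these points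
contribute at least `m ^ (n + 1) |B_ρ| ^ n` at time `(n + 1) τ`. -/
theorem IsJumpKernel.pow_mul_pow_le_heatKernelReg (h : IsJumpKernel a) {τ ρ m : ℝ} (hτ : 0 ≤ τ)
    (hρ : 0 ≤ ρ) (hm : 0 ≤ m) {u : EuclideanSpace ℝ (Fin d)}
    (hu : ∀ w, ‖w - u‖ ≤ 2 * ρ → m ≤ heatKernelReg a w τ) (n : ℕ)
    (z : EuclideanSpace ℝ (Fin d)) (hz : ‖z - ((n : ℝ) + 1) • u‖ ≤ ρ) :
    m ^ (n + 1) * volume.real (Metric.closedBall (0 : EuclideanSpace ℝ (Fin d)) ρ) ^ n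
      ≤ heatKernelReg a z (((n : ℝ) + 1) * τ) := by
  induction n generalizing z with
  | zero =>
    have := hu z (by simp at hz; linarith)
    simpa using this
  | succ n ih =>
    set V := volume.real (Metric.closedBall (0 : EuclideanSpace ℝ (Fin d)) ρ) with hV
    have hVB : volume.real (Metric.closedBall (((n : ℝ) + 1) • u) ρ) = V :=
      Measure.addHaar_real_closedBall_center _ _ _
    have hV0 : 0 ≤ V := measureReal_nonneg
    have hstep := h.mul_measureReal_le_heatKernelReg_add (s := ((n : ℝ) + 1) * τ) (t := τ)
      (by positivity) hτ z (B := Metric.closedBall (((n : ℝ) + 1) • u) ρ)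
      Metric.isClosed_closedBall.measurableSet measure_closedBall_lt_top.ne
      (m := m ^ (n + 1) * V ^ n * m) (fun y hy => by
        have hy' : ‖y - ((n : ℝ) + 1) • u‖ ≤ ρ := by simpa [dist_eq_norm] using hy
        have h1 := ih y hy'
        have h2 := hu (z - y) (by
          have : z - y - u = (z - (((n + 1 : ℕ) : ℝ) + 1) • u) - (y - ((n : ℝ) + 1) • u) := by
            push_cast
            module
          rw [this]
          exact (norm_sub_le _ _).trans (by linarith))
        exact mul_le_mul h1 h2 hm ((by positivity : 0 ≤ m ^ (n + 1) * V ^ n).trans h1))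
    rw [hVB] at hstep
    convert! hstep using 1
    · ring
    · congr 1; push_cast; ring

/-- Lower bound in the moderate deviation regime. The time interval is cut into `⌈b t ^ δ⌉` pieces of
length `τ`, so that the steps `x t / ⌈b t ^ δ⌉` are of order `√τ` and the local limit theorem
applies to each of them. The rate `-‖S r‖² / 2` is recovered as `b → 0`. -/
theorem IsJumpKernel.exists_exp_le_heatKernelReg (h : IsJumpKernel a)
    (h2 : Integrable (fun x => ‖x‖ ^ 2 * a x) volume)
    {S : EuclideanSpace ℝ (Fin d) →L[ℝ] EuclideanSpace ℝ (Fin d)}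
    (hS : ∀ x, invCovForm a x = ‖S x‖ ^ 2) {δ : ℝ} (hδ0 : 0 < δ) (hδ1 : δ < 1)
    {r : EuclideanSpace ℝ (Fin d)} {x : ℝ → EuclideanSpace ℝ (Fin d)}
    (hx : Tendsto (fun t : ℝ => (t ^ ((1 + δ) / 2))⁻¹ • x t) atTop (𝓝 r)) {b : ℝ} (hb : 0 < b) :
    ∃ L : ℝ → ℝ, Tendsto L atTop (𝓝 (b * Real.log (gaussConst a
        * volume.real (Metric.closedBall (0 : EuclideanSpace ℝ (Fin d)) 1) / 2)
        - (‖S r‖ + 2 * ‖S‖ * √b) ^ 2 / 2)) ∧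
      ∀ᶠ t : ℝ in atTop, Real.exp (t ^ δ * L t) ≤ heatKernelReg a (x t) t := by
  have hc := h.gaussConst_pos h2
  set c := gaussConst a with hcdef
  set V₁ := volume.real (Metric.closedBall (0 : EuclideanSpace ℝ (Fin d)) 1) with hV₁
  have hV₁pos : 0 < V₁ :=
    ENNReal.toReal_pos (Metric.measure_closedBall_pos _ _ one_pos).ne' measure_closedBall_lt_top.ne
  set X : ℝ → EuclideanSpace ℝ (Fin d) := fun t => (t ^ ((1 + δ) / 2))⁻¹ • x t with hX
  set N : ℝ → ℕ := fun t => ⌈b * t ^ δ⌉₊ with hN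
  have htδ : Tendsto (fun t : ℝ => t ^ δ) atTop atTop := tendsto_rpow_atTop hδ0
  have hNlim : Tendsto (fun t : ℝ => (N t : ℝ) / t ^ δ) atTop (𝓝 b) :=
    (tendsto_nat_ceil_mul_div_atTop hb.le).comp htδ
  have hlog : Tendsto (fun t : ℝ => (Real.log V₁ + (d : ℝ) / 2 * Real.log t) / t ^ δ) atTop
      (𝓝 0) := by
    have h3 : Tendsto (fun t : ℝ => Real.log t / t ^ δ) atTop (𝓝 0) :=
      (isLittleO_log_rpow_atTop hδ0).tendsto_div_nhds_zero
    have h4 := (htδ.const_div_atTop (Real.log V₁)).add (h3.const_mul ((d : ℝ) / 2))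
    rw [mul_zero, add_zero] at h4
    refine h4.congr fun t => ?_
    ring
  refine ⟨fun t => (N t : ℝ) / t ^ δ * Real.log (c * V₁ / 2)
    - (‖S (X t)‖ + 2 * ‖S‖ * √((N t : ℝ) / t ^ δ)) ^ 2 / 2
    - (Real.log V₁ + (d : ℝ) / 2 * Real.log t) / t ^ δ, ?_, ?_⟩
  · have h3 := (((S.continuous.tendsto r).comp hx).norm.add
      ((Real.continuous_sqrt.tendsto b).comp hNlim |>.const_mul (2 * ‖S‖))).pow 2 |>.div_const 2
    simpa using ((hNlim.mul_const (Real.log (c * V₁ / 2))).sub h3).sub hlog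
  have hτlim : Tendsto (fun t : ℝ => t / N t) atTop atTop := by
    have h3 : Tendsto (fun t : ℝ => t ^ (1 - δ) * ((N t : ℝ) / t ^ δ)⁻¹) atTop atTop :=
      (tendsto_rpow_atTop (by linarith)).atTop_mul_pos (inv_pos.2 hb) (hNlim.inv₀ hb.ne')
    refine h3.congr' ?_
    filter_upwards [eventually_gt_atTop 0] with t ht
    rw [Real.rpow_sub ht, Real.rpow_one, inv_div]
    field_simp
  have hloc := hτlim.eventually
    (h.eventually_heatKernelReg_eq h2 (r := (‖r‖ + 1) / √b + 2) (ε := 1 / 2) one_half_pos)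
  have hXb : ∀ᶠ t in atTop, ‖X t‖ < ‖r‖ + 1 :=
    hx.norm.eventually (gt_mem_nhds (by linarith))
  filter_upwards [hloc, hXb, eventually_ge_atTop 1] with t hloc hXb ht1
  have ht : 0 < t := one_pos.trans_le ht1
  have hN1 : b * t ^ δ ≤ N t := Nat.le_ceil _
  have hNpos : (0 : ℝ) < N t := lt_of_lt_of_le (by positivity) hN1
  obtain ⟨n, hn⟩ : ∃ n, N t = n + 1 := Nat.exists_eq_succ_of_ne_zero (by
    rintro h0; rw [h0] at hNpos; simp at hNpos)
  have hnR : (n : ℝ) + 1 = N t := by rw [hn]; push_cast; rfl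
  set τ := t / N t with hτ
  have hτpos : 0 < τ := by positivity
  set y := t ^ (δ / 2) with hy
  have hypos : 0 < y := by positivity
  have hy2 : t ^ δ = y ^ 2 := by
    rw [hy, ← Real.rpow_natCast, ← Real.rpow_mul ht.le]; congr 1; push_cast; ring
  have hty : t ^ ((1 + δ) / 2) = √t * y := by
    rw [hy, Real.sqrt_eq_rpow, ← Real.rpow_add ht]; congr 1; ring
  have hst : 0 < √t := Real.sqrt_pos.2 ht
  set sN := √(N t : ℝ) with hsN
  have hsNpos : 0 < sN := Real.sqrt_pos.2 hNpos
  have hsN2 : (N t : ℝ) = sN ^ 2 := (Real.sq_sqrt hNpos.le).symm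
  have ht2 : t = √t ^ 2 := (Real.sq_sqrt ht.le).symm
  have hsτ : √τ = √t / sN := by rw [hτ, Real.sqrt_div ht.le]
  have hxX : x t = (√t * y) • X t := by
    rw [hX]
    dsimp only
    rw [hty, smul_inv_smul₀ (by positivity)]
  set u := (N t : ℝ)⁻¹ • x t with hu
  have hbs : √b * y ≤ sN := by
    rw [hsN, ← Real.sqrt_sq hypos.le, ← Real.sqrt_mul hb.le, ← hy2]
    exact Real.sqrt_le_sqrt hN1
  have hunorm : ‖u‖ = √t * y * ‖X t‖ / sN ^ 2 := by
    rw [hu, norm_smul, norm_inv, Real.norm_of_nonneg hNpos.le, hxX, norm_smul,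
      Real.norm_of_nonneg (by positivity), hsN2]
    ring
  have hSu : ‖S u‖ = √t * y * ‖S (X t)‖ / sN ^ 2 := by
    rw [hu, map_smul, norm_smul, norm_inv, Real.norm_of_nonneg hNpos.le, hxX, map_smul, norm_smul,
      Real.norm_of_nonneg (by positivity), hsN2]
    ring
  have hule : ‖u‖ ≤ (‖r‖ + 1) / √b * √τ := by
    have hsb : 0 < √b := Real.sqrt_pos.2 hb
    rw [hunorm, hsτ, div_mul_div_comm, div_le_div_iff₀ (by positivity) (by positivity)]
    have h3 : √b * y * ‖X t‖ ≤ sN * (‖r‖ + 1) := by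
      exact mul_le_mul hbs hXb.le (norm_nonneg _) hsNpos.le
    nlinarith [mul_le_mul_of_nonneg_left h3 (by positivity : 0 ≤ √t * sN)]
  set q := ‖S u‖ + ‖S‖ * (2 * √τ) with hq
  set m := c / τ ^ ((d : ℝ) / 2) * Real.exp (-(q ^ 2 / (2 * τ))) * (1 / 2) with hm
  have hm0 : 0 ≤ m := by positivity
  have hstep : ∀ w, ‖w - u‖ ≤ 2 * √τ → m ≤ heatKernelReg a w τ := fun w hw => by
    have hw1 : ‖w‖ ≤ ((‖r‖ + 1) / √b + 2) * τ ^ ((1 : ℝ) / 2) := by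
      rw [← Real.sqrt_eq_rpow, add_mul]
      calc ‖w‖ = ‖u + (w - u)‖ := by rw [add_sub_cancel]
        _ ≤ _ := (norm_add_le _ _).trans (add_le_add hule hw)
    obtain ⟨η, hη, hv⟩ := hloc w hw1
    have hSw : ‖S w‖ ≤ q := by
      calc ‖S w‖ = ‖S u + S (w - u)‖ := by rw [← map_add, add_sub_cancel]
        _ ≤ ‖S u‖ + ‖S‖ * ‖w - u‖ := (norm_add_le _ _).trans (by gcongr; exact S.le_opNorm _)
        _ ≤ q := by rw [hq]; gcongr
    rw [hv, hS, hm]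
    have h3 : 1 / 2 ≤ 1 + η := by linarith [(abs_le.1 hη).1]
    gcongr
  have hchain := h.pow_mul_pow_le_heatKernelReg hτpos.le (Real.sqrt_nonneg τ) hm0 hstep n (x t) (by
    rw [hnR, hu, smul_inv_smul₀ hNpos.ne', sub_self, norm_zero]
    exact Real.sqrt_nonneg τ)
  rw [hnR, hτ, mul_div_cancel₀ _ hNpos.ne', ← hτ] at hchain
  refine le_trans ?_ hchain
  have hV : volume.real (Metric.closedBall (0 : EuclideanSpace ℝ (Fin d)) (√τ))
      = τ ^ ((d : ℝ) / 2) * V₁ := by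
    rw [Measure.addHaar_real_closedBall' _ _ (Real.sqrt_nonneg τ), finrank_euclideanSpace_fin,
      Real.sqrt_eq_rpow, ← Real.rpow_natCast, ← Real.rpow_mul hτpos.le]
    congr 2; ring
  set V := volume.real (Metric.closedBall (0 : EuclideanSpace ℝ (Fin d)) (√τ)) with hVdef
  have hVpos : 0 < V := by rw [hV]; positivity
  have hcV : 0 < c * V₁ / 2 := by positivity
  have hmV : m * V = Real.exp (Real.log (c * V₁ / 2) - q ^ 2 / (2 * τ)) := by
    rw [sub_eq_add_neg, Real.exp_add, Real.exp_log hcV, hm, hV]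
    field_simp
  have hlogV : Real.log V ≤ Real.log V₁ + (d : ℝ) / 2 * Real.log t := by
    rw [hV, Real.log_mul (by positivity) hV₁pos.ne', Real.log_rpow hτpos, add_comm]
    have h3 : τ ≤ t := div_le_self ht.le (by rw [hn]; push_cast; linarith [Nat.cast_nonneg (α := ℝ) n])
    gcongr
  have hfinal : m ^ (n + 1) * V ^ n
      = Real.exp ((N t : ℝ) * (Real.log (c * V₁ / 2) - q ^ 2 / (2 * τ)) - Real.log V) := by
    rw [Real.exp_sub, Real.exp_log hVpos, Real.exp_nat_mul, ← hmV, hn, eq_div_iff hVpos.ne', mul_pow]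
    ring
  rw [hfinal, Real.exp_le_exp]
  have hNq : (N t : ℝ) * (q ^ 2 / (2 * τ))
      = t ^ δ * ((‖S (X t)‖ + 2 * ‖S‖ * √((N t : ℝ) / t ^ δ)) ^ 2 / 2) := by
    rw [Real.sqrt_div hNpos.le, ← hsN, hy2, Real.sqrt_sq hypos.le, hq, hSu, hsτ, hτ, hsN2]
    field_simp
    linear_combination (-(y * ‖S (X t)‖ + sN * ‖S‖ * 2) ^ 2) * ht2
  have hmain : t ^ δ * ((N t : ℝ) / t ^ δ * Real.log (c * V₁ / 2)
      - (‖S (X t)‖ + 2 * ‖S‖ * √((N t : ℝ) / t ^ δ)) ^ 2 / 2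
      - (Real.log V₁ + (d : ℝ) / 2 * Real.log t) / t ^ δ)
      = (N t : ℝ) * Real.log (c * V₁ / 2) - (N t : ℝ) * (q ^ 2 / (2 * τ))
        - (Real.log V₁ + (d : ℝ) / 2 * Real.log t) := by
    rw [hNq]
    have : t ^ δ ≠ 0 := (by positivity : 0 < t ^ δ).ne'
    field_simp
  rw [hmain]
  linarith

/-! ### Upper bound by exponential tilting -/

theorem integrable_norm_pow_mul_exp_neg {c : ℝ} (hc : 0 < c) (k : ℕ) :
    Integrable (fun x : EuclideanSpace ℝ (Fin d) => ‖x‖ ^ k * Real.exp (-c * ‖x‖)) volume := by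
  have hdecay : Integrable (fun x : EuclideanSpace ℝ (Fin d) =>
      (1 + ‖x‖) ^ (-((d : ℝ) + 1))) volume :=
    integrable_one_add_norm (by rw [finrank_euclideanSpace_fin]; linarith)
  set n := k + (d + 1) with hn
  refine (hdecay.const_mul ((n ! : ℝ) / c ^ n * Real.exp c)).mono' (by fun_prop)
    (ae_of_all _ fun x => ?_)
  have h1 : 0 < 1 + ‖x‖ := by positivity
  have h2 := Real.pow_div_factorial_le_exp (c * (1 + ‖x‖)) (by positivity) n
  rw [Real.norm_of_nonneg (by positivity), Real.rpow_neg h1.le,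
    show (d : ℝ) + 1 = ((d + 1 : ℕ) : ℝ) by push_cast; rfl, Real.rpow_natCast, ← div_eq_mul_inv,
    le_div_iff₀ (by positivity)]
  have h3 : ‖x‖ ^ k ≤ (1 + ‖x‖) ^ k := pow_le_pow_left₀ (norm_nonneg _) (by linarith) k
  have h4 : (1 + ‖x‖) ^ n ≤ (n ! : ℝ) / c ^ n * Real.exp (c * (1 + ‖x‖)) := by
    rw [mul_pow, div_le_iff₀ (by positivity)] at h2
    rw [div_mul_eq_mul_div, le_div_iff₀ (by positivity)]
    linarith
  calc ‖x‖ ^ k * Real.exp (-c * ‖x‖) * (1 + ‖x‖) ^ (d + 1)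
      ≤ (1 + ‖x‖) ^ k * Real.exp (-c * ‖x‖) * (1 + ‖x‖) ^ (d + 1) := by gcongr
    _ = (1 + ‖x‖) ^ n * Real.exp (-c * ‖x‖) := by rw [hn, pow_add]; ring
    _ ≤ (n ! : ℝ) / c ^ n * Real.exp (c * (1 + ‖x‖)) * Real.exp (-c * ‖x‖) := by gcongr
    _ = (n ! : ℝ) / c ^ n * Real.exp c := by
        rw [mul_assoc, ← Real.exp_add]; congr 2; ring

theorem Real.exp_le_quadratic_add_cubic (v : ℝ) :
    Real.exp v ≤ 1 + v + v ^ 2 / 2 + |v| ^ 3 * Real.exp |v| := by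
  have he : 1 ≤ Real.exp |v| := Real.one_le_exp (abs_nonneg v)
  rcases le_or_gt |v| 1 with h1 | h1
  · have h2 := Real.exp_bound h1 (n := 3) (by norm_num)
    have h3 := (abs_le.1 h2).2
    simp only [Finset.sum_range_succ, Finset.sum_range_zero, Nat.factorial] at h3
    norm_num at h3
    have h4 : |v| ^ 3 ≤ |v| ^ 3 * Real.exp |v| := le_mul_of_one_le_right (by positivity) he
    have h5 : 0 ≤ |v| ^ 3 := by positivity
    linarith
  · have h3 : 1 ≤ |v| ^ 3 := one_le_pow₀ h1.le
    have h4 : Real.exp |v| ≤ |v| ^ 3 * Real.exp |v| :=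
      le_mul_of_one_le_left (Real.exp_pos _).le h3
    have h5 : Real.exp v ≤ Real.exp |v| := Real.exp_le_exp.2 (le_abs_self v)
    rcases le_total 0 v with hv | hv
    · have : 0 ≤ v ^ 2 / 2 := by positivity
      linarith
    · have h6 : Real.exp v ≤ 1 := Real.exp_le_one_iff.2 hv
      rw [abs_of_nonpos hv] at *
      have h7 : 1 + -v ≤ Real.exp (-v) := by linarith [Real.add_one_le_exp (-v)]
      have h8 : 0 ≤ v ^ 2 / 2 := by positivity
      linarith

theorem IsJumpKernel.integrable_mul_of_exp_tail (h : IsJumpKernel a) {K β γ C : ℝ} (hβ : γ < β)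
    (hK : ∀ x, a x ≤ K * Real.exp (-β * ‖x‖)) (k : ℕ) {g : EuclideanSpace ℝ (Fin d) → ℝ}
    (hg : Continuous g) (hgC : ∀ x, |g x| ≤ C * (‖x‖ ^ k * Real.exp (γ * ‖x‖))) :
    Integrable (fun x => g x * a x) volume := by
  refine ((integrable_norm_pow_mul_exp_neg (d := d) (sub_pos.2 hβ) k).const_mul (C * K)).mono'
    (hg.aestronglyMeasurable.mul h.integrable.aestronglyMeasurable) (ae_of_all _ fun x => ?_)
  rw [norm_mul, Real.norm_of_nonneg (h.nonneg x), Real.norm_eq_abs]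
  refine (mul_le_mul (hgC x) (hK x) (h.nonneg x) ((abs_nonneg _).trans (hgC x))).trans_eq ?_
  rw [show -(β - γ) * ‖x‖ = γ * ‖x‖ + -β * ‖x‖ by ring, Real.exp_add]
  ring

theorem IsJumpKernel.integral_inner_mul_eq_zero (h : IsJumpKernel a)
    (l : EuclideanSpace ℝ (Fin d)) : ∫ x, inner ℝ l x * a x = 0 := by
  have h1 := integral_neg_eq_self (μ := volume) (fun x => inner ℝ l x * a x)
  have h2 : ∀ x, inner ℝ l (-x) * a (-x) = -(inner ℝ l x * a x) := fun x => by
    rw [inner_neg_right, ← h.symm, neg_mul]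
  simp_rw [h2, integral_neg] at h1
  linarith

/-- Second order expansion of the moment generating function at the origin, with a cubic error. -/
theorem IsJumpKernel.exists_mgf_le (h : IsJumpKernel a) {K β : ℝ} (hβ : 0 < β)
    (hK : ∀ x, a x ≤ K * Real.exp (-β * ‖x‖)) :
    ∃ D : ℝ, ∀ l : EuclideanSpace ℝ (Fin d), ‖l‖ ≤ β / 2 →
      Integrable (fun y => Real.exp (inner ℝ l y) * a y) volume ∧
      1 ≤ ∫ y, Real.exp (inner ℝ l y) * a y ∧
      ∫ y, Real.exp (inner ℝ l y) * a y
        ≤ 1 + (∫ y, inner ℝ y l ^ 2 * a y) / 2 + D * ‖l‖ ^ 3 := by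
  have hβ2 : β / 2 < β := by linarith
  have hi3 : Integrable (fun y => ‖y‖ ^ 3 * Real.exp (β / 2 * ‖y‖) * a y) volume :=
    h.integrable_mul_of_exp_tail hβ2 hK 3 (C := 1) (by fun_prop) fun y => by
      rw [abs_of_nonneg (by positivity), one_mul]
  refine ⟨∫ y, ‖y‖ ^ 3 * Real.exp (β / 2 * ‖y‖) * a y, fun l hl => ?_⟩
  have hexp : ∀ y : EuclideanSpace ℝ (Fin d), |inner ℝ l y| ≤ β / 2 * ‖y‖ := fun y =>
    (abs_real_inner_le_norm l y).trans (by gcongr)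
  have hi0 : Integrable (fun y => Real.exp (inner ℝ l y) * a y) volume :=
    h.integrable_mul_of_exp_tail hβ2 hK 0 (C := 1) (by fun_prop) fun y => by
      rw [abs_of_nonneg (by positivity), one_mul, pow_zero, one_mul]
      exact Real.exp_le_exp.2 ((le_abs_self _).trans (hexp y))
  have hi1 : Integrable (fun y => inner ℝ l y * a y) volume :=
    h.integrable_mul_of_exp_tail (γ := 0) hβ hK 1 (C := ‖l‖) (by fun_prop) fun y => by
      rw [zero_mul, Real.exp_zero, mul_one, pow_one]
      exact abs_real_inner_le_norm l y
  have hi2 : Integrable (fun y => inner ℝ y l ^ 2 * a y) volume :=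
    h.integrable_mul_of_exp_tail (γ := 0) hβ hK 2 (C := ‖l‖ ^ 2) (by fun_prop) fun y => by
      rw [zero_mul, Real.exp_zero, mul_one, abs_pow, ← mul_pow, mul_comm]
      exact pow_le_pow_left₀ (abs_nonneg _) (abs_real_inner_le_norm y l) 2
  have hA : Integrable (fun y => a y + inner ℝ l y * a y) volume := h.integrable.add hi1
  have hB : Integrable (fun y => 1 / 2 * (inner ℝ y l ^ 2 * a y)
      + ‖l‖ ^ 3 * (‖y‖ ^ 3 * Real.exp (β / 2 * ‖y‖) * a y)) volume :=
    (hi2.const_mul _).add (hi3.const_mul _)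
  refine ⟨hi0, ?_, ?_⟩
  · calc (1 : ℝ) = ∫ y, (a y + inner ℝ l y * a y) := by
          rw [integral_add h.integrable hi1, h.mass, h.integral_inner_mul_eq_zero, add_zero]
      _ ≤ ∫ y, Real.exp (inner ℝ l y) * a y := by
          refine integral_mono hA hi0 fun y => ?_
          have := mul_le_mul_of_nonneg_right (Real.add_one_le_exp (inner ℝ l y)) (h.nonneg y)
          dsimp only
          linarith
  · calc ∫ y, Real.exp (inner ℝ l y) * a y
        ≤ ∫ y, ((a y + inner ℝ l y * a y) + (1 / 2 * (inner ℝ y l ^ 2 * a y)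
            + ‖l‖ ^ 3 * (‖y‖ ^ 3 * Real.exp (β / 2 * ‖y‖) * a y))) := by
          refine integral_mono hi0 (hA.add hB) fun y => ?_
          have h1 := mul_le_mul_of_nonneg_right
            (Real.exp_le_quadratic_add_cubic (inner ℝ l y)) (h.nonneg y)
          have h2 : |inner ℝ l y| ^ 3 * Real.exp |inner ℝ l y|
              ≤ (‖l‖ * ‖y‖) ^ 3 * Real.exp (β / 2 * ‖y‖) := by
            gcongr
            · exact abs_real_inner_le_norm l y
            · exact hexp y
          have h3 := mul_le_mul_of_nonneg_right h2 (h.nonneg y)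
          rw [mul_pow] at h3
          rw [real_inner_comm l y] at *
          dsimp only
          linarith
      _ = _ := by
          rw [integral_add hA hB, integral_add h.integrable hi1,
            integral_add (hi2.const_mul _) (hi3.const_mul _),
            integral_const_mul, integral_const_mul, h.mass, h.integral_inner_mul_eq_zero]
          ring

/-- Chernoff bound for the heat kernel. -/
theorem IsJumpKernel.heatKernelReg_le_tilt (h : IsJumpKernel a) {K : ℝ}
    (l : EuclideanSpace ℝ (Fin d)) (hK : ∀ x, a x ≤ K * Real.exp (-inner ℝ l x))
    (hint : Integrable (fun y => Real.exp (inner ℝ l y) * a y) volume)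
    (hM : 1 ≤ ∫ y, Real.exp (inner ℝ l y) * a y) {t : ℝ} (ht : 0 ≤ t)
    (x : EuclideanSpace ℝ (Fin d)) :
    heatKernelReg a x t
      ≤ K * Real.exp (t * ((∫ y, Real.exp (inner ℝ l y) * a y) - 1) - inner ℝ l x) := by
  set M := ∫ y, Real.exp (inner ℝ l y) * a y with hMdef
  have hK0 : 0 ≤ K := by
    have := (h.nonneg 0).trans (hK 0)
    simpa using this
  have hexp := Real.hasSum_pow_div_factorial (t * M)
  have hs1 : Summable fun n : ℕ => (t * M) ^ (n + 1) / ((n + 1)! : ℝ) :=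
    (summable_nat_add_iff 1).2 hexp.summable
  have hle : ∑' n : ℕ, (t * M) ^ (n + 1) / ((n + 1)! : ℝ) ≤ Real.exp (t * M) := by
    rw [← hexp.tsum_eq, hexp.summable.tsum_eq_zero_add]
    simp
  have hterm : ∀ n : ℕ, t ^ (n + 1) * iterConv a n x / ((n + 1)! : ℝ)
      ≤ (t * M) ^ (n + 1) / ((n + 1)! : ℝ) * (K * Real.exp (-inner ℝ l x)) := fun n => by
    rw [mul_pow, mul_div_right_comm, mul_div_right_comm, mul_assoc]
    refine mul_le_mul_of_nonneg_left ?_ (by positivity)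
    calc iterConv a n x ≤ K * M ^ n * Real.exp (-inner ℝ l x) :=
          iterConv_le_tilt h.nonneg l hK hint n x
      _ ≤ K * M ^ (n + 1) * Real.exp (-inner ℝ l x) := by
          have := pow_le_pow_right₀ hM n.le_succ
          gcongr
      _ = _ := by ring
  calc heatKernelReg a x t
      ≤ Real.exp (-t) * ∑' n : ℕ, (t * M) ^ (n + 1) / ((n + 1)! : ℝ)
          * (K * Real.exp (-inner ℝ l x)) :=
        mul_le_mul_of_nonneg_left
          ((h.summable_heat x t).tsum_le_tsum hterm (hs1.mul_right _)) (Real.exp_pos _).le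
    _ ≤ Real.exp (-t) * (Real.exp (t * M) * (K * Real.exp (-inner ℝ l x))) := by
        rw [tsum_mul_right]
        gcongr
    _ = K * Real.exp (t * (M - 1) - inner ℝ l x) := by
        rw [show t * (M - 1) - inner ℝ l x = -t + (t * M + -inner ℝ l x) by ring, Real.exp_add,
          Real.exp_add]
        ring

/-- Upper bound in the moderate deviation regime, by tilting with the vanishing parameter
`t ^ (-(1 - δ) / 2) μ`. -/
theorem IsJumpKernel.exists_heatKernelReg_le_exp (h : IsJumpKernel a) {K β : ℝ} (hβ : 0 < β)
    (hK : ∀ x, a x ≤ K * Real.exp (-β * ‖x‖)) {δ : ℝ} (hδ0 : 0 < δ) (hδ1 : δ < 1)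
    {r : EuclideanSpace ℝ (Fin d)} {x : ℝ → EuclideanSpace ℝ (Fin d)}
    (hx : Tendsto (fun t : ℝ => (t ^ ((1 + δ) / 2))⁻¹ • x t) atTop (𝓝 r))
    (μ : EuclideanSpace ℝ (Fin d)) :
    ∃ U : ℝ → ℝ, Tendsto U atTop (𝓝 ((∫ y, inner ℝ y μ ^ 2 * a y) / 2 - inner ℝ μ r)) ∧
      ∀ᶠ t : ℝ in atTop, heatKernelReg a (x t) t ≤ Real.exp (t ^ δ * U t) := by
  obtain ⟨D, hD⟩ := h.exists_mgf_le hβ hK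
  set K' := max K 1 with hK'
  have hK'pos : 0 < K' := one_pos.trans_le (le_max_right _ _)
  have hslim : Tendsto (fun t : ℝ => t ^ (-((1 - δ) / 2))) atTop (𝓝 0) :=
    tendsto_rpow_neg_atTop (by linarith)
  set vμ := ∫ y, inner ℝ y μ ^ 2 * a y with hv
  refine ⟨fun t => Real.log K' / t ^ δ + vμ / 2 + D * ‖μ‖ ^ 3 * t ^ (-((1 - δ) / 2))
    - inner ℝ μ ((t ^ ((1 + δ) / 2))⁻¹ • x t), ?_, ?_⟩
  · have h1 := ((((tendsto_rpow_atTop hδ0).const_div_atTop (Real.log K')).add_const (vμ / 2)).add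
      (hslim.const_mul (D * ‖μ‖ ^ 3))).sub (tendsto_const_nhds (x := μ) |>.inner hx)
    simpa using h1
  have hsmall : ∀ᶠ t : ℝ in atTop, t ^ (-((1 - δ) / 2)) * ‖μ‖ < β / 2 := by
    have h1 := hslim.mul_const ‖μ‖
    rw [zero_mul] at h1
    exact h1.eventually (gt_mem_nhds (by positivity))
  filter_upwards [hsmall, eventually_gt_atTop 0] with t hsm ht
  set s := t ^ (-((1 - δ) / 2)) with hs
  have hspos : 0 < s := by positivity
  have hl : ‖s • μ‖ ≤ β / 2 := by
    rw [norm_smul, Real.norm_of_nonneg hspos.le]; exact hsm.le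
  obtain ⟨hint, hM1, hM2⟩ := hD (s • μ) hl
  have hKl : ∀ y, a y ≤ K' * Real.exp (-inner ℝ (s • μ) y) := fun y => by
    refine (hK y).trans ?_
    refine mul_le_mul (le_max_left _ _) (Real.exp_le_exp.2 ?_) (Real.exp_pos _).le hK'pos.le
    have h1 := (le_abs_self _).trans (abs_real_inner_le_norm (s • μ) y)
    have h2 : ‖s • μ‖ * ‖y‖ ≤ β * ‖y‖ := by
      gcongr
      linarith
    linarith
  refine (h.heatKernelReg_le_tilt (s • μ) hKl hint hM1 ht.le (x t)).trans ?_
  rw [← Real.exp_log hK'pos, ← Real.exp_add, Real.exp_log hK'pos, Real.exp_le_exp]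
  have hts : t * s ^ 2 = t ^ δ := by
    rw [hs, ← Real.rpow_natCast, ← Real.rpow_mul ht.le]
    nth_rw 1 [← Real.rpow_one t]
    rw [← Real.rpow_add ht]
    congr 1; push_cast; ring
  have htδ : t ^ δ ≠ 0 := (by positivity : 0 < t ^ δ).ne'
  have hsx : s * inner ℝ μ (x t) = t ^ δ * inner ℝ μ ((t ^ ((1 + δ) / 2))⁻¹ • x t) := by
    rw [inner_smul_right, ← mul_assoc, ← Real.rpow_neg ht.le, ← Real.rpow_add ht, hs]
    congr 2; ring
  have hvs : ∫ y, inner ℝ y (s • μ) ^ 2 * a y = s ^ 2 * vμ := by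
    rw [hv, ← integral_const_mul]
    congr with y
    rw [inner_smul_right]; ring
  rw [hvs, norm_smul, Real.norm_of_nonneg hspos.le] at hM2
  have h1 := mul_le_mul_of_nonneg_left hM2 ht.le
  rw [real_inner_smul_left, hsx]
  have h2 : t * (1 + s ^ 2 * vμ / 2 + D * (s * ‖μ‖) ^ 3)
      = t + t ^ δ * (vμ / 2 + D * ‖μ‖ ^ 3 * s) := by
    rw [← hts]; ring
  rw [h2] at h1
  have h3 : t ^ δ * (Real.log K' / t ^ δ + vμ / 2 + D * ‖μ‖ ^ 3 * s
      - inner ℝ μ ((t ^ ((1 + δ) / 2))⁻¹ • x t))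
      = Real.log K' + t ^ δ * (vμ / 2 + D * ‖μ‖ ^ 3 * s)
        - t ^ δ * inner ℝ μ ((t ^ ((1 + δ) / 2))⁻¹ • x t) := by
    field_simp
    ring
  rw [h3, mul_sub]
  linarith

/-! ### Moderate deviations -/

/-- Logarithmic asymptotics in the moderate deviation regime. In the upper bound the tilt `μ` is
`σ⁻¹ r`, that is, the solution of `T μ = S r`. -/
theorem IsJumpKernel.tendsto_log_heatKernelReg (h : IsJumpKernel a)
    (h2 : Integrable (fun x => ‖x‖ ^ 2 * a x) volume) {K β : ℝ} (hβ : 0 < β)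
    (hK : ∀ x, a x ≤ K * Real.exp (-β * ‖x‖)) {δ : ℝ} (hδ0 : 0 < δ) (hδ1 : δ < 1)
    {r : EuclideanSpace ℝ (Fin d)} {x : ℝ → EuclideanSpace ℝ (Fin d)}
    (hx : Tendsto (fun t : ℝ => (t ^ ((1 + δ) / 2))⁻¹ • x t) atTop (𝓝 r)) :
    (∀ᶠ t : ℝ in atTop, 0 < heatKernelReg a (x t) t) ∧
      Tendsto (fun t : ℝ => Real.log (heatKernelReg a (x t) t) / t ^ δ) atTop
        (𝓝 (-(invCovForm a r / 2))) := by
  obtain ⟨T, S, hT, hS, hTS, -, hdet0⟩ := h.exists_covariance_factor h2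
  have hpos : ∀ᶠ t : ℝ in atTop, 0 < heatKernelReg a (x t) t := by
    obtain ⟨L, -, hL⟩ := h.exists_exp_le_heatKernelReg h2 hS hδ0 hδ1 hx one_pos
    exact hL.mono fun t ht => (Real.exp_pos _).trans_le ht
  refine ⟨hpos, tendsto_order.2 ⟨fun l hl => ?_, fun l hl => ?_⟩⟩
  · -- the rate of the chaining bound tends to `-‖S r‖² / 2` as `b → 0`
    have hlim : Tendsto (fun b : ℝ => b * Real.log (gaussConst a
        * volume.real (Metric.closedBall (0 : EuclideanSpace ℝ (Fin d)) 1) / 2)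
        - (‖S r‖ + 2 * ‖S‖ * √b) ^ 2 / 2) (𝓝[>] 0) (𝓝 (-(invCovForm a r / 2))) := by
      have hcont : Continuous fun b : ℝ => b * Real.log (gaussConst a
          * volume.real (Metric.closedBall (0 : EuclideanSpace ℝ (Fin d)) 1) / 2)
          - (‖S r‖ + 2 * ‖S‖ * √b) ^ 2 / 2 := by fun_prop
      have := (hcont.tendsto 0).mono_left (nhdsWithin_le_nhds (s := Set.Ioi 0))
      simpa [hS] using this
    obtain ⟨b, hbl, hb⟩ :=
      ((hlim.eventually (lt_mem_nhds hl)).and self_mem_nhdsWithin).exists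
    obtain ⟨L, hLlim, hL⟩ := h.exists_exp_le_heatKernelReg h2 hS hδ0 hδ1 hx hb
    filter_upwards [hLlim.eventually (lt_mem_nhds hbl), hL, eventually_gt_atTop 0]
      with t hlt hLt ht
    have htδ : 0 < t ^ δ := by positivity
    rw [lt_div_iff₀ htδ]
    have h3 := Real.log_le_log (Real.exp_pos _) hLt
    rw [Real.log_exp] at h3
    nlinarith
  · obtain ⟨μ, hμ⟩ : ∃ μ, T μ = S r :=
      (LinearMap.equivOfDetNeZero (T : EuclideanSpace ℝ (Fin d) →ₗ[ℝ] EuclideanSpace ℝ (Fin d))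
        hdet0).surjective (S r)
    obtain ⟨U, hUlim, hU⟩ := h.exists_heatKernelReg_le_exp hβ hK hδ0 hδ1 hx μ
    have hval : (∫ y, inner ℝ y μ ^ 2 * a y) / 2 - inner ℝ μ r = -(invCovForm a r / 2) := by
      rw [← hT, hS, real_inner_comm, ← hTS, hμ, real_inner_self_eq_norm_sq]
      ring
    rw [hval] at hUlim
    filter_upwards [hUlim.eventually (gt_mem_nhds hl), hU, hpos, eventually_gt_atTop 0]
      with t hlt hUt hv ht
    have htδ : 0 < t ^ δ := by positivity
    rw [div_lt_iff₀ htδ]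
    have h3 := Real.log_le_log hv hUt
    rw [Real.log_exp] at h3
    nlinarith

/-- Logarithmic asymptotics rewritten as an exponential with a relative error in the exponent. -/
theorem exists_eventually_eq_exp_mul_one_add {v w m : ℝ → ℝ} {ℓ : ℝ} (hℓ : 0 < ℓ)
    (hv : ∀ᶠ t in atTop, 0 < v t) (hw : ∀ᶠ t in atTop, 0 < w t)
    (hlog : Tendsto (fun t => Real.log (v t) / w t) atTop (𝓝 (-ℓ)))
    (hm : Tendsto m atTop (𝓝 ℓ)) :
    ∃ η : ℝ → ℝ, Tendsto η atTop (𝓝 0) ∧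
      ∀ᶠ t in atTop, v t = Real.exp (-(w t * m t) * (1 + η t)) := by
  refine ⟨fun t => Real.log (v t) / w t / (-m t) - 1, ?_, ?_⟩
  · have := (hlog.div hm.neg (neg_ne_zero.2 hℓ.ne')).sub_const 1
    rwa [div_self (neg_ne_zero.2 hℓ.ne'), sub_self] at this
  · filter_upwards [hv, hw, hm.eventually (lt_mem_nhds hℓ)] with t hvt hwt hmt
    have : -(w t * m t) * (1 + (Real.log (v t) / w t / (-m t) - 1)) = Real.log (v t) := by
      field_simp
      ring
    rw [this, Real.exp_log hvt]

theorem exists_exp_neg_mul_norm_bound (ha : ∀ x, 0 ≤ a x)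
    (htail : ∃ C b p : ℝ, 0 < b ∧ 1 ≤ p ∧ ∀ x, a x ≤ C * Real.exp (-b * ‖x‖ ^ p)) :
    ∃ K β : ℝ, 0 < β ∧ ∀ x, a x ≤ K * Real.exp (-β * ‖x‖) := by
  obtain ⟨C, b, p, hb, hp, hC⟩ := htail
  have hC0 : 0 ≤ C := nonneg_of_mul_nonneg_left ((ha 0).trans (hC 0)) (Real.exp_pos _)
  refine ⟨C * Real.exp b, b, hb, fun x => (hC x).trans ?_⟩
  rw [mul_assoc, ← Real.exp_add]
  have h1 : ‖x‖ ≤ ‖x‖ ^ p + 1 := by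
    rcases le_total 1 ‖x‖ with hx | hx
    · have := Real.rpow_le_rpow_of_exponent_le hx hp
      rw [Real.rpow_one] at this
      linarith
    · have : 0 ≤ ‖x‖ ^ p := by positivity
      linarith
  have h2 : -b * ‖x‖ ^ p ≤ b + -b * ‖x‖ := by nlinarith
  gcongr

theorem mainTheorem2 {d : ℕ} (hd : 1 ≤ d) (a : EuclideanSpace ℝ (Fin d) → ℝ)
    (ha_nonneg : ∀ x, 0 ≤ a x)
    (ha_symm : ∀ x, a x = a (-x))
    (ha_bdd : MemLp a ⊤ volume)
    (ha_int : Integrable a volume)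
    (ha_mass : ∫ x, a x = 1)
    (ha_mom : Integrable (fun x => ‖x‖ ^ 2 * a x) volume)
    (ha_tail : ∃ C b p : ℝ, 0 < b ∧ 1 ≤ p ∧ ∀ x, a x ≤ C * Real.exp (-b * ‖x‖ ^ p)) :
    (∀ r : ℝ, 0 < r → ∀ ε : ℝ, 0 < ε → ∀ᶠ t : ℝ in atTop,
      ∀ x : EuclideanSpace ℝ (Fin d), ‖x‖ ≤ r * t ^ ((1 : ℝ) / 2) →
        ∃ η : ℝ, |η| ≤ ε ∧
          heatKernelReg a x t =
            gaussConst a / t ^ ((d : ℝ) / 2) *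
              Real.exp (-(invCovForm a x / (2 * t))) * (1 + η)) ∧
    (∀ (r : EuclideanSpace ℝ (Fin d)) (δ : ℝ), r ≠ 0 → 0 < δ → δ < 1 →
      ∀ x : ℝ → EuclideanSpace ℝ (Fin d),
        Tendsto (fun t : ℝ => (t ^ ((1 + δ) / 2))⁻¹ • x t) atTop (𝓝 r) →
        (∃ η : ℝ → ℝ, Tendsto η atTop (𝓝 0) ∧ ∀ᶠ t : ℝ in atTop,
          heatKernelReg a (x t) t =
            Real.exp (-(invCovForm a (x t) / (2 * t)) * (1 + η t))) ∧
        (∃ η : ℝ → ℝ, Tendsto η atTop (𝓝 0) ∧ ∀ᶠ t : ℝ in atTop,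
          heatKernelReg a (x t) t =
            Real.exp (-(1 / 2 * invCovForm a r * t ^ δ) * (1 + η t)))) := by
  obtain ⟨K, β, hβ, hK⟩ := exists_exp_neg_mul_norm_bound ha_nonneg ha_tail
  have hK0 : 0 ≤ K := nonneg_of_mul_nonneg_left ((ha_nonneg 0).trans (hK 0)) (Real.exp_pos _)
  have h : IsJumpKernel a :=
    { nonneg := ha_nonneg
      symm := ha_symm
      integrable := ha_int
      mass := ha_mass
      bdd := ⟨K, fun x => (hK x).trans (mul_le_of_le_one_right hK0
        (Real.exp_le_one_iff.2 (by nlinarith [norm_nonneg x])))⟩ }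
  refine ⟨fun r _ ε hε => h.eventually_heatKernelReg_eq ha_mom hε,
    fun r δ hr hδ0 hδ1 x hx => ?_⟩
  obtain ⟨T, S, -, hS, hTS, -, -⟩ := h.exists_covariance_factor ha_mom
  have hq : 0 < invCovForm a r / 2 := by
    have h0 : S r ≠ 0 := fun h0 => hr (by
      rw [← inner_self_eq_zero (𝕜 := ℝ), ← hTS, h0, inner_zero_left])
    rw [hS]
    positivity
  obtain ⟨hpos, hlog⟩ := h.tendsto_log_heatKernelReg ha_mom hβ hK hδ0 hδ1 hx
  have hw : ∀ᶠ t : ℝ in atTop, 0 < t ^ δ := by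
    filter_upwards [eventually_gt_atTop 0] with t ht using by positivity
  constructor
  · have hm : Tendsto (fun t : ℝ => invCovForm a ((t ^ ((1 + δ) / 2))⁻¹ • x t) / 2) atTop
        (𝓝 (invCovForm a r / 2)) := by
      simp_rw [hS]
      exact ((((S.continuous.tendsto r).comp hx).norm.pow 2).div_const 2)
    obtain ⟨η, hη, hv⟩ := exists_eventually_eq_exp_mul_one_add hq hpos hw hlog hm
    refine ⟨η, hη, ?_⟩
    filter_upwards [hv, eventually_gt_atTop 0] with t hvt ht
    rw [hvt]
    congr 3
    rw [hS, hS, map_smul, norm_smul, norm_inv, Real.norm_of_nonneg (by positivity), mul_pow,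
      inv_pow, ← Real.rpow_natCast, ← Real.rpow_mul ht.le,
      show (1 + δ) / 2 * ((2 : ℕ) : ℝ) = 1 + δ by push_cast; ring, Real.rpow_add ht, Real.rpow_one]
    have : t ^ δ ≠ 0 := (by positivity : 0 < t ^ δ).ne'
    field_simp
  · obtain ⟨η, hη, hv⟩ :=
      exists_eventually_eq_exp_mul_one_add hq hpos hw hlog (tendsto_const_nhds (x := invCovForm a r / 2))
    refine ⟨η, hη, hv.mono fun t hvt => ?_⟩
    rw [hvt]
    congr 3
    ring
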